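/- Let $A$ be a finite set and let $M\in M_A(\mathbb Z)$ be an irreducible Pisot unimodular matrix: its characteristic polynomial is irreducible over $\mathbb Q$, $\det M=\pm1$, and its eigenvalue $\beta$ of maximal modulus is a Pisot number (a real algebraic integer $>1$ all of whose other conjugates have modulus $<1$). Let $\mathcal P\subset\mathbb R^A$ be a hyperplane complementary to the eigenspace $E_\beta$ of $M$ for $\beta$, and let $\pi:\mathbb R^A\to\mathcal P$ be the projection onto $\mathcal P$ along $E_\beta$. For $U\subseteq\mathcal P$ put $Q_U=\{x\in\mathbb N^A : \pi(x)\in U\}$, and define the interior of $S\subseteq\mathbb Z^A$ by $$\overset{\circ}{S}=\bigcup\{Q_U : U\subseteq\mathcal P \text{ open},\ Q_U\subseteq S\}.$$ For a finite word $u=u_0u_1\cdots u_{n-1}$ with letters in $\mathbb Z^A$ put $Q_u=\sum_{k=0}^{n-1}M^k u_k$, and for a language $L$ put $Q_L=\{Q_u : u\in L\}$ and $\overset{\circ}{L}=\{u\in L : Q_u\in\overset{\circ}{Q}_L\}$, where $\overset{\circ}{Q}_L$ is the interior of $Q_L$. Then, for every regular language $L$ over a finite alphabet $\Sigma\subset\mathbb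 Z^A$, the language $\overset{\circ}{L}$ is regular and $Q_{\overset{\circ}{L}}=\overset{\circ}{Q}_L$. Moreover, $\overset{\circ}{L}$ is computable from $L$: there is a single algorithm (a partial recursive function) which, for every $d$ and $A=\{1,\dots,d\}$, given an irreducible Pisot unimodular matrix $M\in M_d(\mathbb Z)$ and a finite automaton recognizing a language $L$ over a finite alphabet in $\mathbb Z^d$, halts and returns a finite automaton recognizing $\overset{\circ}{L}$, whatever the choice of the hyperplane $\mathcal P$. -/

import Mathlib

open Matrix

/-- The value `Q_u = ∑_{k < |u|} M ^ k u_k` of a finite word `u` of integer vectors. -/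
def wordValue {A : Type*} [Fintype A] [DecidableEq A] (M : Matrix A A ℤ)
    (u : List (A → ℤ)) : A → ℤ :=
  ∑ k : Fin u.length, (M ^ (k : ℕ)) *ᵥ u.get k

/-- `Q_L`, the set of the values of the words of the language `L`. -/
def languageValue {A : Type*} [Fintype A] [DecidableEq A] (M : Matrix A A ℤ)
    (L : Language (A → ℤ)) : Set (A → ℤ) :=
  {x | ∃ u ∈ L, wordValue M u = x}

/-- `β` is a Pisot number: a real algebraic integer greater than one, all of whose other
(complex) conjugates have modulus less than one. -/
structure IsPisot (β : ℝ) : Prop where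
  isIntegral : IsIntegral ℤ β
  one_lt : 1 < β
  norm_conj_lt_one : ∀ z ∈ (minpoly ℚ β).aroots ℂ, z ≠ (β : ℂ) → ‖z‖ < 1

/-- `M` is an irreducible Pisot unimodular integer matrix with maximal eigenvalue `β`. -/
structure IsIrreduciblePisotUnimodular {A : Type*} [Fintype A] [DecidableEq A]
    (M : Matrix A A ℤ) (β : ℝ) : Prop where
  irreducible : Irreducible (M.map (Int.cast : ℤ → ℚ)).charpoly
  det_eq : M.det = 1 ∨ M.det = -1
  hasEigenvalue : Module.End.HasEigenvalue (Matrix.toLin' (M.map (Int.cast : ℤ → ℝ))) β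
  maximal : ∀ z ∈ (M.map (Int.cast : ℤ → ℂ)).charpoly.roots, ‖z‖ ≤ β
  isPisot : IsPisot β

/-- The eigenspace in `ℝ^A` of the integer matrix `M` for the real number `β`. -/
noncomputable def realEigenspace {A : Type*} [Fintype A] [DecidableEq A] (M : Matrix A A ℤ)
    (β : ℝ) : Submodule ℝ (A → ℝ) :=
  Module.End.eigenspace (Matrix.toLin' (M.map (Int.cast : ℤ → ℝ))) β

/-- `Q_U`, the points of `ℕ^A` (seen as the nonnegative vectors of `ℤ^A`) that the linear map
`π : ℝ^A → P` sends into `U`. -/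
def discreteLine {A : Type*} {P : Submodule ℝ (A → ℝ)} (π : (A → ℝ) →ₗ[ℝ] P) (U : Set P) :
    Set (A → ℤ) :=
  {x | (∀ a, 0 ≤ x a) ∧ π (fun a => (x a : ℝ)) ∈ U}

/-- The interior of a subset `S` of `ℤ^A`: the union of the sets `Q_U`, with `U` open in `P`,
that are contained in `S`. -/
def discreteInterior {A : Type*} {P : Submodule ℝ (A → ℝ)} (π : (A → ℝ) →ₗ[ℝ] P)
    (S : Set (A → ℤ)) : Set (A → ℤ) :=
  ⋃₀ {V | (∃ U : Set P, IsOpen U ∧ V = discreteLine π U) ∧ V ⊆ S}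

/-- The language of the words `u ∈ L` such that `Q_u` is in the interior of `Q_L`. -/
def interiorLanguage {A : Type*} [Fintype A] [DecidableEq A] (M : Matrix A A ℤ)
    {P : Submodule ℝ (A → ℝ)} (π : (A → ℝ) →ₗ[ℝ] P) (L : Language (A → ℤ)) :
    Language (A → ℤ) :=
  {u | u ∈ L ∧ wordValue M u ∈ discreteInterior π (languageValue M L)}

/-- A finite (nondeterministic) automaton as finite data: the list of the initial states, the
list of the final states, and the list of the transitions `(p, a, q)`. States are natural
numbers, and a letter `a ∈ ℤ^d` is given by the list of its `d` coordinates. -/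
abbrev AutomatonCode : Type := List ℕ × List ℕ × List (ℕ × List ℤ × ℕ)

/-- The automaton over `ℤ^d` described by the code `c`. -/
def AutomatonCode.toNFA (d : ℕ) (c : AutomatonCode) : NFA (Fin d → ℤ) ℕ where
  step p a := {q | (p, List.ofFn a, q) ∈ c.2.2}
  start := {p | p ∈ c.1}
  accept := {p | p ∈ c.2.1}

/-- The language over `ℤ^d` recognized by the automaton described by the code `c`. -/
def AutomatonCode.language (d : ℕ) (c : AutomatonCode) : Language (Fin d → ℤ) :=
  (c.toNFA d).accepts

/-- An integer matrix given as the list of its rows. -/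
def matrixCode {d : ℕ} (M : Matrix (Fin d) (Fin d) ℤ) : List (List ℤ) :=
  List.ofFn fun i => List.ofFn (M i)

/-!
The eigenspace `E_β` and the contracting eigenspaces of `M` split the value of a word into an
expanding and a contracting part. Words with letters in a box have values with bounded contracting
part, and conversely every integer vector with small contracting part is the value of such a word.
Hence `u` belongs to the interior language if and only if, for some `k`, every word
`u 0 ⋯ 0 w` with `k` zeros, letters in a suitable box and a value with nonnegative coordinates has
its value in `Q_L`.

This condition is regular, because two languages have state maps with finitely many values:
* the sign of a coordinate of the value is determined by the last letters of the word, as soon as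
  the expanding part of their value is large;
* the differences between the values of two words with equal value, cut at the same place, are
  confined to a box, so that membership in `Q_L` is tested by a finite transducer.

Both state maps are as explicit as the bound for the contracting parts. In the characteristic
polynomial of a high power of `M`, one coefficient exceeds the sum of the absolute values of all
the others, hence `M` satisfies an integer relation with one dominant coefficient. Such a relation
bounds every bounded orbit `x_{j+1} = M x_j + e_j` in terms of the errors `e_j`, and it can be
found by search. Words shorter than the number of the states then decide whether a given automaton
recognizes the interior language, and the algorithm searches for one.
-/

section WordValue

variable {A : Type*} [Fintype A] [DecidableEq A] (M : Matrix A A ℤ)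

@[simp]
theorem wordValue_nil : wordValue M [] = 0 := by
  simp [wordValue]

@[simp]
theorem wordValue_cons (a : A → ℤ) (u : List (A → ℤ)) :
    wordValue M (a :: u) = a + M *ᵥ wordValue M u := by
  have h : wordValue M (a :: u) = ∑ k : Fin (u.length + 1), (M ^ (k : ℕ)) *ᵥ (a :: u).get k := rfl
  rw [h, Fin.sum_univ_succ]
  simp only [wordValue, mulVec_sum, mulVec_mulVec, Fin.val_zero, pow_zero, one_mulVec,
    Fin.val_succ, pow_succ']
  rfl

theorem wordValue_append (u v : List (A → ℤ)) :
    wordValue M (u ++ v) = wordValue M u + (M ^ u.length) *ᵥ wordValue M v := by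
  induction u with
  | nil => simp
  | cons a u ih =>
    simp only [List.cons_append, wordValue_cons, ih, List.length_cons, pow_succ', mulVec_add,
      mulVec_mulVec, add_assoc]

@[simp]
theorem wordValue_replicate_zero (k : ℕ) :
    wordValue M (List.replicate k (0 : A → ℤ)) = 0 := by
  induction k with
  | zero => simp
  | succ k ih => simp [List.replicate_succ, ih]

end WordValue

section StateMap

variable {α C D : Type*} {f : List α → C} {L L₁ L₂ : Language α}

/-- `f` is a state map for `L`: as for the state reached by a deterministic automaton, the value
`f u` determines which continuations of the word `u` belong to `L`. Unlike the state of an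
automaton, `f (u ++ [a])` need not be a function of `f u` and `a`. -/
def IsStateMap (f : List α → C) (L : Language α) : Prop :=
  ∀ ⦃u v⦄, f u = f v → ∀ w, u ++ w ∈ L ↔ v ++ w ∈ L

theorem isStateMap_leftQuotient (L : Language α) : IsStateMap L.leftQuotient L := by
  intro u v huv w
  rw [← Language.mem_leftQuotient, huv, Language.mem_leftQuotient]

namespace IsStateMap

theorem of_factorsThrough {g : List α → D} (h : IsStateMap f L) (hfg : f.FactorsThrough g) :
    IsStateMap g L :=
  fun _ _ huv => h (hfg huv)

theorem isRegular [Finite C] (h : IsStateMap f L) : L.IsRegular := by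
  refine Language.IsRegular.of_finite_range_leftQuotient ?_
  have hfactors : L.leftQuotient.FactorsThrough f := fun u v huv => by
    ext w
    exact h huv w
  obtain ⟨g, hg⟩ := (Function.factorsThrough_iff _).1 hfactors
  rw [hg, Set.range_comp]
  exact Set.toFinite _

end IsStateMap

variable [Fintype C]

theorem exists_sublist_length_lt (f : List α → C) (p : List α) {w : List α}
    (hw : Fintype.card C ≤ w.length) :
    ∃ x : List α, x.Sublist w ∧ x.length < w.length ∧
      ∀ L : Language α, IsStateMap f L → ∀ s, p ++ w ++ s ∈ L ↔ p ++ x ++ s ∈ L := by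
  obtain ⟨i, j, hij, hf⟩ := Fintype.exists_ne_map_eq_of_card_lt
    (fun i : Fin (w.length + 1) => f (p ++ w.take i)) (by simpa using Nat.lt_succ_of_le hw)
  wlog hlt : i < j generalizing i j
  · exact this j i hij.symm hf.symm (hij.symm.lt_of_le (not_lt.1 hlt))
  have hij' : (i : ℕ) < j := hlt
  refine ⟨w.take i ++ w.drop j, ?_, ?_, fun L hL s => ?_⟩
  · simpa only [List.take_append_drop] using
      (List.Sublist.refl (w.take i)).append (List.drop_sublist_drop_left w hij'.le)
  · simp only [List.length_append, List.length_take, List.length_drop]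
    omega
  · have h := hL hf (w.drop j ++ s)
    rw [List.append_assoc p (w.take j), ← List.append_assoc (w.take j), List.take_append_drop] at h
    simpa only [List.append_assoc] using h.symm

theorem exists_sublist_length_lt_card (f : List α → C) (p w : List α) :
    ∃ x : List α, x.Sublist w ∧ x.length < Fintype.card C ∧
      ∀ L : Language α, IsStateMap f L → ∀ s, p ++ w ++ s ∈ L ↔ p ++ x ++ s ∈ L := by
  induction hn : w.length using Nat.strong_induction_on generalizing w with
  | _ n ih =>
    by_cases hw : w.length < Fintype.card C
    · exact ⟨w, List.Sublist.refl w, hw, fun _ _ _ => Iff.rfl⟩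
    · obtain ⟨x, hxw, hx, hLx⟩ := exists_sublist_length_lt f p (not_lt.1 hw)
      obtain ⟨y, hyx, hy, hLy⟩ := ih x.length (hn ▸ hx) x rfl
      exact ⟨y, hyx.trans hxw, hy, fun L hL s => (hLx L hL s).trans (hLy L hL s)⟩

theorem exists_replicate_lt_card (f : List α → C) (p : List α) (z : α) (k : ℕ) :
    ∃ m < Fintype.card C, ∀ L : Language α, IsStateMap f L →
      ∀ s, p ++ List.replicate k z ++ s ∈ L ↔ p ++ List.replicate m z ++ s ∈ L := by
  obtain ⟨x, hxw, hx, hL⟩ := exists_sublist_length_lt_card f p (List.replicate k z)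
  obtain ⟨m, _, rfl⟩ := List.sublist_replicate_iff.1 hxw
  exact ⟨m, by simpa using hx, hL⟩

theorem eq_of_forall_mem_iff_of_length_lt (h₁ : IsStateMap f L₁) (h₂ : IsStateMap f L₂) {B : Set α}
    (hB₁ : ∀ u ∈ L₁, ∀ a ∈ u, a ∈ B) (hB₂ : ∀ u ∈ L₂, ∀ a ∈ u, a ∈ B) {S : ℕ}
    (hS : Fintype.card C ≤ S)
    (h : ∀ u : List α, u.length < S → (∀ a ∈ u, a ∈ B) → (u ∈ L₁ ↔ u ∈ L₂)) : L₁ = L₂ := by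
  ext u
  by_cases hu : ∀ a ∈ u, a ∈ B
  · obtain ⟨x, hxu, hx, hL⟩ := exists_sublist_length_lt_card f [] u
    have h₁x := hL L₁ h₁ []
    have h₂x := hL L₂ h₂ []
    simp only [List.nil_append, List.append_nil] at h₁x h₂x
    rw [h₁x, h₂x]
    exact h x (hx.trans_le hS) fun a ha => hu a (hxu.subset ha)
  · exact iff_of_false (fun hu₁ => hu (hB₁ u hu₁)) fun hu₂ => hu (hB₂ u hu₂)

end StateMap

section PadClosure

variable {α C : Type*} {f : List α → C} {L L₁ L₂ : Language α}

/-- The words that belong to `L` after appending some power of the letter `z`. -/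
def padClosure (z : α) (L : Language α) : Language α :=
  {t | ∃ k, t ++ List.replicate k z ∈ L}

theorem IsStateMap.padClosure (h : IsStateMap f L) (z : α) : IsStateMap f (padClosure z L) :=
  fun u v huv w => exists_congr fun k => by
    simpa only [List.append_assoc] using h huv (w ++ List.replicate k z)

theorem IsStateMap.mem_padClosure_iff [Fintype C] (h : IsStateMap f L) {S : ℕ}
    (hS : Fintype.card C ≤ S) (z : α) (t : List α) :
    t ∈ _root_.padClosure z L ↔ ∃ k < S, t ++ List.replicate k z ∈ L := by
  refine ⟨fun ⟨k, hk⟩ => ?_, fun ⟨k, _, hk⟩ => ⟨k, hk⟩⟩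
  obtain ⟨m, hm, hL⟩ := exists_replicate_lt_card f t z k
  exact ⟨m, hm.trans_le hS, by simpa using (hL L h []).1 (by simpa using hk)⟩

/-- The words `u` of `L ∩ L₁` such that, for some `m`, each word `u z ^ m w` of `L₁` with the
letters of `w` in `B` is in `L₂`. With `z = 0`, the letters of `B` then change the value of `u`
only by a multiple of a high power of `M`, that is, by a small amount modulo the expanding line. -/
def stableInterior (B : Set α) (z : α) (L L₁ L₂ : Language α) : Language α :=
  {u | u ∈ L ∧ u ∈ L₁ ∧ ∃ m, ∀ w : List α, (∀ a ∈ w, a ∈ B) →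
    u ++ List.replicate m z ++ w ∈ L₁ → u ++ List.replicate m z ++ w ∈ L₂}

theorem IsStateMap.stableInterior (h : IsStateMap f L) (h₁ : IsStateMap f L₁)
    (h₂ : IsStateMap f L₂) (B : Set α) (z : α) : IsStateMap f (stableInterior B z L L₁ L₂) := by
  refine fun u v huv w => and_congr (h huv w) (and_congr (h₁ huv w) (exists_congr fun m =>
    forall_congr' fun x => forall_congr' fun _ => ?_))
  simpa only [List.append_assoc] using
    imp_congr (h₁ huv (w ++ List.replicate m z ++ x)) (h₂ huv (w ++ List.replicate m z ++ x))

theorem mem_stableInterior_iff_of_isStateMap [Fintype C] (h₁ : IsStateMap f L₁)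
    (h₂ : IsStateMap f L₂) {S : ℕ} (hS : Fintype.card C ≤ S) (B : Set α) (z : α) (u : List α) :
    u ∈ stableInterior B z L L₁ L₂ ↔ u ∈ L ∧ u ∈ L₁ ∧ ∃ m < S, ∀ w : List α, w.length < S →
      (∀ a ∈ w, a ∈ B) →
      u ++ List.replicate m z ++ w ∈ L₁ → u ++ List.replicate m z ++ w ∈ L₂ := by
  refine and_congr_right fun _ => and_congr_right fun _ => ⟨?_, ?_⟩
  · rintro ⟨k, hk⟩
    obtain ⟨m, hm, hL⟩ := exists_replicate_lt_card f u z k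
    exact ⟨m, hm.trans_le hS, fun w _ hw hw₁ =>
      (hL L₂ h₂ w).1 (hk w hw ((hL L₁ h₁ w).2 hw₁))⟩
  · rintro ⟨m, _, hm⟩
    refine ⟨m, fun w hw hw₁ => ?_⟩
    obtain ⟨x, hxw, hx, hL⟩ := exists_sublist_length_lt_card f (u ++ List.replicate m z) w
    have h₁x := hL L₁ h₁ []
    have h₂x := hL L₂ h₂ []
    simp only [List.append_nil] at h₁x h₂x
    exact h₂x.2 (hm x (hx.trans_le hS) (fun a ha => hw a (hxw.subset ha)) (h₁x.1 hw₁))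

end PadClosure

section Eigenvector

open Polynomial

variable {A K : Type*} [Fintype A] [DecidableEq A]

theorem pow_mulVec_of_mulVec_eq_smul [CommRing K] {N : Matrix A A K} {b : K} {w : A → K}
    (hw : N *ᵥ w = b • w) (k : ℕ) : (N ^ k) *ᵥ w = b ^ k • w := by
  induction k with
  | zero => simp
  | succ k ih => rw [pow_succ', ← mulVec_mulVec, ih, mulVec_smul, hw, smul_smul, pow_succ]

theorem aeval_mulVec_of_mulVec_eq_smul [CommRing K] {N : Matrix A A K} {b : K} {w : A → K}
    (hw : N *ᵥ w = b • w) (f : K[X]) : aeval N f *ᵥ w = f.eval b • w := by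
  simp only [aeval_eq_sum_range, eval_eq_sum_range, sum_mulVec, smul_mulVec,
    pow_mulVec_of_mulVec_eq_smul hw, smul_smul, Finset.sum_smul]

theorem charpoly_dvd_of_aeval_apply_eq_zero [Field K] {N : Matrix A A K}
    (hN : Irreducible N.charpoly) {i : A} {f : K[X]} (hf : aeval N f i = 0) : N.charpoly ∣ f := by
  by_contra hdvd
  obtain ⟨a, b, hab⟩ := hN.coprime_iff_not_dvd.2 hdvd
  have h := congrFun₂ (congrArg (aeval N) (hab.symm.trans (by rw [mul_comm b]))) i i
  simp [mul_apply, aeval_self_charpoly, hf] at h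

theorem exists_aeval_apply_eq [Field K] {N : Matrix A A K} (hN : Irreducible N.charpoly) (i : A)
    (v : A → K) : ∃ f : K[X], aeval N f i = v := by
  let row : K[X] →ₗ[K] (A → K) := LinearMap.proj i ∘ₗ (aeval N).toLinearMap
  have hker : LinearMap.ker row = (Ideal.span {N.charpoly}).restrictScalars K := by
    ext f
    rw [LinearMap.mem_ker, Submodule.restrictScalars_mem, Ideal.mem_span_singleton]
    refine ⟨charpoly_dvd_of_aeval_apply_eq_zero hN, fun ⟨g, hg⟩ => ?_⟩
    have hf : aeval N f = 0 := by rw [hg, map_mul, aeval_self_charpoly, zero_mul]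
    exact congrFun hf i
  have hrank : Module.finrank K (LinearMap.range row) = Module.finrank K (A → K) := by
    rw [← row.quotKerEquivRange.finrank_eq, hker, Module.finrank_fintype_fun_eq_card,
      ← charpoly_natDegree_eq_dim N]
    exact finrank_quotient_span_eq_natDegree
  exact LinearMap.range_eq_top.1 (Submodule.eq_top_of_finrank_eq hrank) v

theorem eq_zero_of_apply_eq_zero_of_irreducible_charpoly {L : Type*} [Field K] [Field L]
    [Algebra K L] {N : Matrix A A K} (hN : Irreducible N.charpoly) {b : L} {w : A → L}
    (hw : N.map (algebraMap K L) *ᵥ w = b • w) {i : A} (hi : w i = 0) : w = 0 := by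
  ext j
  obtain ⟨f, hf⟩ := exists_aeval_apply_eq hN i (Pi.single j 1)
  have hmap : aeval (N.map (algebraMap K L)) (f.map (algebraMap K L)) =
      (aeval N f).map (algebraMap K L) := by
    rw [aeval_map_algebraMap]
    exact aeval_algHom_apply (Algebra.ofId K L).mapMatrix N f
  have h := congrFun (aeval_mulVec_of_mulVec_eq_smul hw (f.map (algebraMap K L))) i
  rw [Pi.smul_apply, hi, smul_zero, hmap] at h
  simpa [mulVec, dotProduct, hf, Pi.single_apply] using h

end Eigenvector

section SpectralProjection

open Polynomial Filter Topology

theorem exists_eval_eq_one_dvd_X_sub_C_mul {K : Type*} [Field K] {p : K[X]} {b : K}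
    (hp : p.Separable) (hb : p.IsRoot b) : ∃ q : K[X], q.eval b = 1 ∧ p ∣ (X - C b) * q := by
  obtain ⟨h, rfl⟩ := dvd_iff_isRoot.2 hb
  have hb' : h.eval b ≠ 0 := by
    simpa using hp.aeval_derivative_ne_zero (x := b) (by simp)
  exact ⟨C (h.eval b)⁻¹ * h, by simp [hb'], C (h.eval b)⁻¹, by ring⟩

theorem isIdempotentElem_aeval {K E : Type*} [CommRing K] [Ring E] [Algebra K E] {a : E} {b : K}
    {q : K[X]} (hq : q.eval b = 1) (ha : aeval a ((X - C b) * q) = 0) :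
    IsIdempotentElem (aeval a q) := by
  obtain ⟨f, hf⟩ : X - C b ∣ 1 - q := dvd_iff_isRoot.2 (by simp [hq])
  have h : aeval a ((1 - q) * q) = 0 := by
    rw [hf, mul_right_comm, map_mul, ha, zero_mul]
  rw [sub_mul, one_mul, map_sub, map_mul, sub_eq_zero] at h
  exact h.symm

variable {E : Type*} [NormedRing E] [NormedAlgebra ℂ E] [CompleteSpace E] {a : E}

theorem tendsto_norm_pow_of_spectralRadius_lt_one (h : spectralRadius ℂ a < 1) :
    Tendsto (fun k => ‖a ^ k‖) atTop (𝓝 0) := by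
  obtain ⟨r, hr, hr1⟩ := ENNReal.lt_iff_exists_nnreal_btwn.1 h
  have hroot := (spectrum.pow_nnnorm_pow_one_div_tendsto_nhds_spectralRadius a).eventually
    (gt_mem_nhds hr)
  refine squeeze_zero' (Eventually.of_forall fun _ => norm_nonneg _) ?_
    (tendsto_pow_atTop_nhds_zero_of_lt_one r.2 (show (r : ℝ) < 1 by exact_mod_cast hr1))
  filter_upwards [hroot, eventually_gt_atTop 0] with n hn hn0
  have hpow : (‖a ^ n‖₊ : ENNReal) ≤ (r : ENNReal) ^ n := by
    have := ENNReal.rpow_le_rpow hn.le (Nat.cast_nonneg (α := ℝ) n)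
    rwa [← ENNReal.rpow_mul, one_div, inv_mul_cancel₀ (by positivity), ENNReal.rpow_one,
      ENNReal.rpow_natCast] at this
  exact_mod_cast hpow

theorem tendsto_norm_pow_mul_one_sub_aeval [Nontrivial E] {b : ℂ} {q : ℂ[X]}
    (hq : q.eval b = 1) (ha : aeval a ((X - C b) * q) = 0)
    (hspec : ∀ z ∈ spectrum ℂ a, z ≠ b → ‖z‖ < 1) :
    Tendsto (fun k => ‖a ^ k * (1 - aeval a q)‖) atTop (𝓝 0) := by
  have hidem : IsIdempotentElem (1 - aeval a q) := (isIdempotentElem_aeval hq ha).one_sub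
  have hcomm : Commute a (1 - aeval a q) := by
    have hX : Commute a (aeval a q) := by simpa using (Commute.all X q).map (aeval (R := ℂ) a)
    exact (Commute.one_right a).sub_right hX
  have hspec' : ∀ z ∈ spectrum ℂ (aeval a (X * (1 - q))), ‖z‖ < 1 := by
    rw [spectrum.map_polynomial_aeval_of_nonempty _ _ (spectrum.nonempty a)]
    rintro _ ⟨x, hx, rfl⟩
    have hxq : (x - b) * q.eval x = 0 := by
      have h := spectrum.subset_polynomial_aeval a ((X - C b) * q) ⟨x, hx, rfl⟩
      simpa [ha, spectrum.zero_eq] using h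
    rcases eq_or_ne x b with rfl | hxb
    · simp [hq]
    · simpa [(mul_eq_zero.1 hxq).resolve_left (sub_ne_zero.2 hxb)] using hspec x hx hxb
  have hradius : spectralRadius ℂ (aeval a (X * (1 - q))) < 1 := by
    exact_mod_cast spectrum.spectralRadius_lt_of_forall_lt (r := 1) _ hspec'
  refine (tendsto_norm_pow_of_spectralRadius_lt_one hradius).congr' ?_
  filter_upwards [eventually_ne_atTop 0] with k hk
  obtain ⟨k, rfl⟩ := Nat.exists_eq_succ_of_ne_zero hk
  rw [map_mul, aeval_X, map_sub, map_one, hcomm.mul_pow, hidem.pow_succ_eq]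

end SpectralProjection

section RealSplitting

open Polynomial Filter Topology
open scoped Matrix.Norms.Operator

variable {A : Type*} [Fintype A] [DecidableEq A]

theorem linfty_opNorm_map_ofReal (N : Matrix A A ℝ) : ‖N.map (algebraMap ℝ ℂ)‖ = ‖N‖ := by
  simp [linfty_opNorm_def]

theorem tendsto_norm_pow_mul_one_sub_aeval_real [Nonempty A] {N : Matrix A A ℝ} {b : ℝ} {q : ℝ[X]}
    (hq : q.eval b = 1) (hN : aeval N ((X - C b) * q) = 0)
    (hroots : ∀ z : ℂ, aeval z N.charpoly = 0 → z ≠ b → ‖z‖ < 1) :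
    Tendsto (fun k => ‖N ^ k * (1 - aeval N q)‖) atTop (𝓝 0) := by
  let φ : Matrix A A ℝ →ₐ[ℝ] Matrix A A ℂ := (Algebra.ofId ℝ ℂ).mapMatrix
  have hmap (f : ℝ[X]) : aeval (φ N) (f.map (algebraMap ℝ ℂ)) = φ (aeval N f) := by
    rw [aeval_map_algebraMap, aeval_algHom_apply]
  have h : Tendsto (fun k => ‖φ N ^ k * (1 - aeval (φ N) (q.map (algebraMap ℝ ℂ)))‖)
      atTop (𝓝 0) := by
    refine tendsto_norm_pow_mul_one_sub_aeval (b := (b : ℂ)) ?_ ?_ fun z hz => hroots z ?_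
    · rw [← Complex.coe_algebraMap, eval_map_apply, hq, map_one]
    · have h := hmap ((X - C b) * q)
      rw [hN, map_zero] at h
      simpa using h
    · have hφ : φ N = N.map (algebraMap ℝ ℂ) := rfl
      rw [mem_spectrum_iff_isRoot_charpoly, hφ, charpoly_map, IsRoot, eval_map_algebraMap] at hz
      exact hz
  refine h.congr fun k => ?_
  rw [hmap, ← map_pow, ← map_one φ, ← map_sub, ← map_mul]
  exact linfty_opNorm_map_ofReal _

/-- The real matrix of an integer matrix. -/
abbrev realMatrix (M : Matrix A A ℤ) : Matrix A A ℝ := M.map (Int.cast : ℤ → ℝ)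

/-- The real vector of an integer vector. -/
def realVector {A : Type*} (x : A → ℤ) : A → ℝ := fun a => (x a : ℝ)

@[simp]
theorem realVector_apply {A : Type*} (x : A → ℤ) (a : A) : realVector x a = x a := rfl

@[simp]
theorem realVector_zero {A : Type*} : realVector (0 : A → ℤ) = 0 := by
  ext
  simp

theorem realVector_add {A : Type*} (x y : A → ℤ) :
    realVector (x + y) = realVector x + realVector y := by
  ext
  simp

theorem realVector_sub {A : Type*} (x y : A → ℤ) :
    realVector (x - y) = realVector x - realVector y := by
  ext
  simp

/-- `R` is a projection of `ℝ^A` onto the eigenspace of `M` for the expanding eigenvalue `β`, it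
commutes with `M`, and the powers of `M` tend to zero on its kernel. -/
structure IsPisotSplitting (M : Matrix A A ℤ) (β : ℝ) (R : Matrix A A ℝ) : Prop where
  one_lt : 1 < β
  commute : Commute (realMatrix M) R
  mul_eq : realMatrix M * R = β • R
  mulVec_eq_self : ∀ w, realMatrix M *ᵥ w = β • w → R *ᵥ w = w
  tendsto : Tendsto (fun k => ‖realMatrix M ^ k * (1 - R)‖) atTop (𝓝 0)

omit [DecidableEq A] in
theorem realVector_mulVec (M : Matrix A A ℤ) (x : A → ℤ) :
    realVector (M *ᵥ x) = realMatrix M *ᵥ realVector x := by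
  ext i
  simp [realVector, mulVec, dotProduct]

theorem realMatrix_pow (M : Matrix A A ℤ) (k : ℕ) : realMatrix (M ^ k) = realMatrix M ^ k :=
  Matrix.map_pow M (Int.castRingHom ℝ) k

theorem realVector_pow_mulVec (M : Matrix A A ℤ) (k : ℕ) (x : A → ℤ) :
    realVector ((M ^ k) *ᵥ x) = (realMatrix M ^ k) *ᵥ realVector x := by
  rw [realVector_mulVec, realMatrix_pow]

namespace IsPisotSplitting

variable {M : Matrix A A ℤ} {β : ℝ} {R : Matrix A A ℝ} (h : IsPisotSplitting M β R)
include h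

theorem mulVec_mulVec (x : A → ℝ) : realMatrix M *ᵥ (R *ᵥ x) = β • (R *ᵥ x) := by
  rw [Matrix.mulVec_mulVec, h.mul_eq, smul_mulVec]

theorem isIdempotentElem : IsIdempotentElem R := by
  refine ext_of_mulVec_single fun j => ?_
  rw [← Matrix.mulVec_mulVec]
  exact h.mulVec_eq_self _ (h.mulVec_mulVec _)

theorem mulVec_pow_mulVec (k : ℕ) (x : A → ℝ) :
    R *ᵥ ((realMatrix M ^ k) *ᵥ x) = β ^ k • (R *ᵥ x) := by
  rw [Matrix.mulVec_mulVec, ← (h.commute.pow_left k).eq, ← Matrix.mulVec_mulVec,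
    pow_mulVec_of_mulVec_eq_smul (h.mulVec_mulVec x)]

theorem commute_one_sub : Commute (realMatrix M) (1 - R) :=
  (Commute.one_right _).sub_right h.commute

theorem eventually_norm_pow_mulVec_le {ε : ℝ} (hε : 0 < ε) :
    ∀ᶠ k in atTop, ∀ x, ‖(realMatrix M ^ k) *ᵥ ((1 - R) *ᵥ x)‖ ≤ ε * ‖x‖ := by
  filter_upwards [h.tendsto.eventually (gt_mem_nhds hε)] with k hk x
  rw [Matrix.mulVec_mulVec]
  exact (linfty_opNorm_mulVec _ _).trans (mul_le_mul_of_nonneg_right hk.le (norm_nonneg x))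

end IsPisotSplitting

end RealSplitting

section Pisot

open Polynomial

variable {A : Type*} [Fintype A] [DecidableEq A]

theorem charpoly_realMatrix (M : Matrix A A ℤ) :
    (realMatrix M).charpoly = (M.map (Int.cast : ℤ → ℚ)).charpoly.map (algebraMap ℚ ℝ) := by
  rw [← charpoly_map]
  congr 1

namespace IsIrreduciblePisotUnimodular

variable {M : Matrix A A ℤ} {β : ℝ} (hM : IsIrreduciblePisotUnimodular M β)
include hM

theorem isRoot_charpoly : (realMatrix M).charpoly.IsRoot β := by
  rw [← charpoly_toLin', ← Module.End.hasEigenvalue_iff_isRoot_charpoly]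
  exact hM.hasEigenvalue

theorem minpoly_eq : minpoly ℚ β = (M.map (Int.cast : ℤ → ℚ)).charpoly := by
  have h := hM.isRoot_charpoly
  rw [charpoly_realMatrix, IsRoot, eval_map_algebraMap] at h
  exact (minpoly.eq_of_irreducible_of_monic hM.irreducible h (charpoly_monic _)).symm

theorem separable_charpoly : (realMatrix M).charpoly.Separable := by
  rw [charpoly_realMatrix]
  exact hM.irreducible.separable.map

theorem nonempty : Nonempty A := by
  by_contra hA
  rw [not_nonempty_iff] at hA
  have h := hM.irreducible
  rw [charpoly, det_isEmpty] at h
  exact h.not_isUnit isUnit_one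

theorem norm_lt_one {z : ℂ} (hz : aeval z (realMatrix M).charpoly = 0) (hne : z ≠ β) :
    ‖z‖ < 1 := by
  refine hM.isPisot.norm_conj_lt_one z ?_ hne
  rw [hM.minpoly_eq, mem_aroots]
  rw [charpoly_realMatrix, aeval_map_algebraMap] at hz
  exact ⟨(charpoly_monic _).ne_zero, hz⟩

theorem exists_isPisotSplitting : ∃ R, IsPisotSplitting M β R := by
  have := hM.nonempty
  obtain ⟨q, hq, f, hf⟩ :=
    exists_eval_eq_one_dvd_X_sub_C_mul hM.separable_charpoly hM.isRoot_charpoly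
  have h : aeval (realMatrix M) ((X - C β) * q) = 0 := by
    rw [hf, map_mul, aeval_self_charpoly, zero_mul]
  refine ⟨aeval (realMatrix M) q, hM.isPisot.one_lt, ?_, ?_, fun w hw => ?_,
    tendsto_norm_pow_mul_one_sub_aeval_real hq h fun z hz hne => hM.norm_lt_one hz hne⟩
  · simpa using (Commute.all X q).map (aeval (realMatrix M))
  · rw [map_mul, map_sub, aeval_X, aeval_C, sub_mul, sub_eq_zero] at h
    rw [h, Algebra.algebraMap_eq_smul_one, smul_mul_assoc, one_mul]
  · rw [aeval_mulVec_of_mulVec_eq_smul hw, hq, one_smul]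

theorem eq_zero_of_apply_eq_zero {w : A → ℝ} (hw : realMatrix M *ᵥ w = β • w) {i : A}
    (hi : w i = 0) : w = 0 := by
  refine eq_zero_of_apply_eq_zero_of_irreducible_charpoly hM.irreducible (b := β) ?_ hi
  convert hw using 2
  ext
  simp

end IsIrreduciblePisotUnimodular

end Pisot

section Orbit

variable {E : Type*} [SeminormedAddCommGroup E] [NormedSpace ℝ E] {T : Module.End ℝ E}
  {x e : ℤ → E} {μ a : ℝ}

theorem norm_sub_pow_apply_le (hμ : 1 ≤ μ) (hT : ∀ v, ‖T v‖ ≤ μ * ‖v‖)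
    (hx : ∀ j, x (j + 1) = T (x j) + e j) (he : ∀ j, ‖e j‖ ≤ a) (k : ℕ) (j : ℤ) :
    ‖x (j + k) - (T ^ k) (x j)‖ ≤ k * μ ^ k * a := by
  have ha : 0 ≤ a := (norm_nonneg _).trans (he 0)
  induction k with
  | zero => simp
  | succ k ih =>
    have hstep : x (j + (k + 1 : ℕ)) - (T ^ (k + 1)) (x j) =
        T (x (j + k) - (T ^ k) (x j)) + e (j + k) := by
      rw [Nat.cast_succ, ← add_assoc, hx, pow_succ', map_sub, Module.End.mul_apply]
      abel
    calc ‖x (j + (k + 1 : ℕ)) - (T ^ (k + 1)) (x j)‖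
        ≤ μ * ‖x (j + k) - (T ^ k) (x j)‖ + a := by
          rw [hstep]
          exact (norm_add_le _ _).trans (add_le_add (hT _) (he _))
      _ ≤ μ * (k * μ ^ k * a) + μ ^ (k + 1) * a := by
          gcongr
          exact le_mul_of_one_le_left ha (one_le_pow₀ hμ)
      _ = (k + 1 : ℕ) * μ ^ (k + 1) * a := by
          push_cast
          ring

theorem abs_mul_norm_le_of_relation (hμ : 1 ≤ μ) (hT : ∀ v, ‖T v‖ ≤ μ * ‖v‖)
    (hx : ∀ j, x (j + 1) = T (x j) + e j) (he : ∀ j, ‖e j‖ ≤ a) {B : ℝ} (hB : ∀ j, ‖x j‖ ≤ B)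
    {n : ℕ} {c : ℕ → ℝ} (hc : ∀ v, ∑ i ∈ Finset.range n, c i • (T ^ i) v = 0) {k : ℕ}
    (hk : k ∈ Finset.range n) (j : ℤ) :
    |c k| * ‖x j‖ ≤ (∑ i ∈ Finset.range n, |c i| - |c k|) * B +
      (∑ i ∈ Finset.range n, |c i|) * (n * μ ^ n) * a := by
  have ha : 0 ≤ a := (norm_nonneg _).trans (he 0)
  obtain ⟨l, rfl⟩ : ∃ l, j = l + k := ⟨j - k, by ring⟩
  have hsum : c k • x (l + k) = ∑ i ∈ Finset.range n, c i • (x (l + i) - (T ^ i) (x l)) -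
      ∑ i ∈ (Finset.range n).erase k, c i • x (l + i) := by
    rw [eq_sub_iff_add_eq, Finset.add_sum_erase _ (fun i : ℕ => c i • x (l + i)) hk]
    simp only [smul_sub, Finset.sum_sub_distrib, hc, sub_zero]
  have herror : ‖∑ i ∈ Finset.range n, c i • (x (l + i) - (T ^ i) (x l))‖ ≤
      (∑ i ∈ Finset.range n, |c i|) * (n * μ ^ n) * a := by
    rw [mul_assoc, Finset.sum_mul]
    refine norm_sum_le_of_le _ fun i hi => ?_
    have hin : i ≤ n := (Finset.mem_range.1 hi).le
    rw [norm_smul, Real.norm_eq_abs]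
    refine mul_le_mul_of_nonneg_left ((norm_sub_pow_apply_le hμ hT hx he i l).trans ?_)
      (abs_nonneg _)
    gcongr
  have hothers : ‖∑ i ∈ (Finset.range n).erase k, c i • x (l + i)‖ ≤
      (∑ i ∈ Finset.range n, |c i| - |c k|) * B := by
    rw [← Finset.sum_erase_eq_sub hk, Finset.sum_mul]
    refine norm_sum_le_of_le _ fun i _ => ?_
    rw [norm_smul, Real.norm_eq_abs]
    exact mul_le_mul_of_nonneg_left (hB _) (abs_nonneg _)
  rw [← Real.norm_eq_abs, ← norm_smul, hsum, add_comm]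
  exact (norm_sub_le _ _).trans (add_le_add herror hothers)

theorem norm_le_of_dominant_relation (hμ : 1 ≤ μ) (hT : ∀ v, ‖T v‖ ≤ μ * ‖v‖)
    (hx : ∀ j, x (j + 1) = T (x j) + e j) (he : ∀ j, ‖e j‖ ≤ a) {B : ℝ} (hB : ∀ j, ‖x j‖ ≤ B)
    {n : ℕ} {c : ℕ → ℝ} (hc : ∀ v, ∑ i ∈ Finset.range n, c i • (T ^ i) v = 0) {k : ℕ}
    (hk : k ∈ Finset.range n) (hdom : ∑ i ∈ Finset.range n, |c i| + 1 ≤ 2 * |c k|) (j : ℤ) :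
    ‖x j‖ ≤ (∑ i ∈ Finset.range n, |c i|) * (n * μ ^ n) * a := by
  have hbdd : BddAbove (Set.range fun j => ‖x j‖) := ⟨B, Set.forall_mem_range.2 hB⟩
  have hle : ∀ j, ‖x j‖ ≤ ⨆ j, ‖x j‖ := le_ciSup hbdd
  have _ : 0 ≤ ∑ i ∈ Finset.range n, |c i| := Finset.sum_nonneg fun i _ => abs_nonneg _
  have hsup : |c k| * ⨆ j, ‖x j‖ ≤ (∑ i ∈ Finset.range n, |c i| - |c k|) * (⨆ j, ‖x j‖) +
      (∑ i ∈ Finset.range n, |c i|) * (n * μ ^ n) * a := by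
    rw [Real.mul_iSup_of_nonneg (abs_nonneg _)]
    exact ciSup_le (abs_mul_norm_le_of_relation hμ hT hx he hle hc hk)
  have h0 : 0 ≤ ⨆ j, ‖x j‖ := (norm_nonneg _).trans (hle 0)
  exact (hle j).trans (by nlinarith)

end Orbit

section DominantRelation

open Polynomial Filter Topology
open scoped Matrix.Norms.Operator

variable {A : Type*} [Fintype A] [DecidableEq A]

theorem det_aeval {K : Type*} [Field K] [IsAlgClosed K] (M : Matrix A A K) (f : K[X]) :
    (aeval M f).det = (M.charpoly.roots.map fun a => f.eval a).prod := by
  have hM : M.charpoly.Splits := IsAlgClosed.splits _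
  have hcard : M.charpoly.roots.card = Fintype.card A := by
    rw [← hM.natDegree_eq_card_roots, charpoly_natDegree_eq_dim]
  induction IsAlgClosed.splits f using Submonoid.closure_induction with
  | mem f hf =>
    rcases hf with ⟨y, rfl⟩ | ⟨y, rfl⟩
    · simp [hcard, Algebra.algebraMap_eq_smul_one]
    · have hdet : (aeval M (X + C y)).det = (-1) ^ Fintype.card A * M.charpoly.eval (-y) := by
        have h : aeval M (X + C y) = -(scalar A (-y) - M) := by
          rw [map_add, aeval_X, aeval_C, map_neg, neg_sub, sub_neg_eq_add]
          rfl
        rw [h, det_neg, eval_charpoly]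
      rw [hdet, hM.eval_eq_prod_roots_of_monic (charpoly_monic M), ← hcard,
        ← Multiset.card_map (fun a => -y - a), ← Multiset.prod_map_neg, Multiset.map_map]
      simp
  | one => simp
  | mul f g _ _ hf hg => simp [hf, hg, Multiset.prod_map_mul]

theorem charpoly_aeval {K : Type*} [Field K] [IsAlgClosed K] (M : Matrix A A K) (f : K[X]) :
    (aeval M f).charpoly = (M.charpoly.roots.map fun a => X - C (f.eval a)).prod := by
  refine Polynomial.funext fun x => ?_
  have h : x • 1 - aeval M f = aeval M (C x - f) := by
    simp [Algebra.algebraMap_eq_smul_one]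
  rw [eval_charpoly, scalar_apply, ← smul_one_eq_diagonal, h, det_aeval, eval_multiset_prod,
    Multiset.map_map]
  simp

theorem charpoly_pow {K : Type*} [Field K] [IsAlgClosed K] (M : Matrix A A K) (m : ℕ) :
    (M ^ m).charpoly = (M.charpoly.roots.map fun a => X - C (a ^ m)).prod := by
  simpa using charpoly_aeval M (X ^ m)

theorem tendsto_coeff_prod_X_sub_C_pow {s : Multiset ℂ} (hs : ∀ a ∈ s, ‖a‖ < 1) (k : ℕ) :
    Tendsto (fun m : ℕ => ((s.map fun a => X - C (a ^ m)).prod : ℂ[X]).coeff k) atTop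
      (𝓝 (((X : ℂ[X]) ^ s.card).coeff k)) := by
  induction s using Multiset.induction_on generalizing k with
  | empty => simp
  | cons a s ih =>
    obtain ⟨ha, hs⟩ := Multiset.forall_mem_cons.1 hs
    have h := (tendsto_pow_atTop_nhds_zero_of_norm_lt_one ha).mul (ih hs k)
    simp only [Multiset.map_cons, Multiset.prod_cons, Multiset.card_cons, sub_mul, coeff_sub,
      coeff_C_mul, pow_succ']
    cases k with
    | zero => simpa [mul_coeff_zero] using h.neg
    | succ k => simpa only [coeff_X_mul, zero_mul, sub_zero] using (ih hs k).sub h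

theorem tendsto_inv_pow_mul_coeff_prod_X_sub_C_pow {b : ℂ} {s : Multiset ℂ} (hb : 1 < ‖b‖)
    (hs : ∀ a ∈ s, ‖a‖ < 1) (k : ℕ) :
    Tendsto (fun m : ℕ => (b ^ m)⁻¹ * (((b ::ₘ s).map fun a => X - C (a ^ m)).prod : ℂ[X]).coeff k)
      atTop (𝓝 (-((X : ℂ[X]) ^ s.card).coeff k)) := by
  have hb0 : b ≠ 0 := norm_pos_iff.1 (one_pos.trans hb)
  have hinv : Tendsto (fun m : ℕ => (b ^ m)⁻¹) atTop (𝓝 0) := by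
    simpa only [inv_pow] using tendsto_pow_atTop_nhds_zero_of_norm_lt_one
      (x := b⁻¹) (by simpa using inv_lt_one_of_one_lt₀ hb)
  simp only [Multiset.map_cons, Multiset.prod_cons, sub_mul, coeff_sub, coeff_C_mul, mul_sub,
    inv_mul_cancel_left₀ (pow_ne_zero _ hb0)]
  rw [← zero_sub]
  refine Tendsto.sub ?_ (tendsto_coeff_prod_X_sub_C_pow hs k)
  cases k with
  | zero => simp [mul_coeff_zero]
  | succ k => simpa using hinv.mul (tendsto_coeff_prod_X_sub_C_pow hs k)

theorem eventually_sum_norm_coeff_lt {b : ℂ} {s : Multiset ℂ} (hb : 1 < ‖b‖)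
    (hs : ∀ a ∈ s, ‖a‖ < 1) :
    ∀ᶠ m : ℕ in atTop, ∀ P : ℂ[X], P = ((b ::ₘ s).map fun a => X - C (a ^ m)).prod →
      ∑ i ∈ Finset.range (s.card + 2), ‖P.coeff i‖ < 2 * ‖P.coeff s.card‖ := by
  have hb0 : b ≠ 0 := norm_pos_iff.1 (one_pos.trans hb)
  have hlim := fun k => (tendsto_inv_pow_mul_coeff_prod_X_sub_C_pow hb hs k).norm
  have hlt := (tendsto_finsetSum (Finset.range (s.card + 2)) fun i _ => hlim i).eventually_lt
    ((hlim s.card).const_mul 2) (by simp [coeff_X_pow, apply_ite])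
  filter_upwards [hlt] with m hm P hP
  rw [← hP] at hm
  have hpos : 0 < ‖(b ^ m)⁻¹‖ := norm_pos_iff.2 (inv_ne_zero (pow_ne_zero _ hb0))
  simpa only [norm_mul, ← Finset.mul_sum, mul_left_comm (2 : ℝ), mul_lt_mul_iff_right₀ hpos]
    using hm

/-- The integers `g` are the coefficients, in increasing degree, of a polynomial that annihilates
`M`, one of which exceeds in absolute value the sum of all the others. The first condition is
stated through `wordValue`, which the algorithm computes. -/
structure IsDominantRelation (M : Matrix A A ℤ) (g : List ℤ) : Prop where
  wordValue_eq_zero : ∀ v, wordValue M (g.map (· • v)) = 0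
  dominant : ∃ c ∈ g, (g.map Int.natAbs).sum < 2 * c.natAbs

theorem wordValue_map_range (M : Matrix A A ℤ) (n : ℕ) (w : ℕ → A → ℤ) :
    wordValue M ((List.range n).map w) = ∑ i ∈ Finset.range n, (M ^ i) *ᵥ w i := by
  induction n with
  | zero => simp
  | succ n ih => simp [List.range_succ, wordValue_append, ih, Finset.sum_range_succ]

theorem map_eq_map_range_getD {α : Type*} (g : List ℤ) (f : ℤ → α) :
    g.map f = (List.range g.length).map fun i => f (g.getD i 0) :=
  List.ext_getElem (by simp) fun i hi _ => by
    rw [List.length_map] at hi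
    simp [hi]

theorem wordValue_map_smul (M : Matrix A A ℤ) (g : List ℤ) (v : A → ℤ) :
    wordValue M (g.map (· • v)) = (∑ i ∈ Finset.range g.length, g.getD i 0 • M ^ i) *ᵥ v := by
  rw [map_eq_map_range_getD, wordValue_map_range]
  simp only [sum_mulVec, smul_mulVec, mulVec_smul]

theorem IsDominantRelation.of_aeval_eq_zero {M : Matrix A A ℤ} {p : ℤ[X]} (hp : aeval M p = 0)
    {k : ℕ} (hk : p.sum (fun _ c => c.natAbs) < 2 * (p.coeff k).natAbs) :
    IsDominantRelation M ((List.range (p.natDegree + 1)).map p.coeff) where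
  wordValue_eq_zero v := by
    rw [List.map_map]
    refine (wordValue_map_range M _ _).trans ?_
    simp_rw [Function.comp_apply, mulVec_smul, ← smul_mulVec]
    rw [← sum_mulVec, ← aeval_eq_sum_range, hp, zero_mulVec]
  dominant := by
    refine ⟨p.coeff k, List.mem_map.2 ⟨k, ?_, rfl⟩, ?_⟩
    · rw [List.mem_range, Nat.lt_succ_iff]
      refine le_natDegree_of_ne_zero fun h => ?_
      simp [h] at hk
    · rw [sum_over_range _ fun _ => Int.natAbs_zero] at hk
      rwa [List.map_map]

theorem sum_expand_eq {m : ℕ} (hm : 0 < m) (p : ℤ[X]) (f : ℤ → ℕ) :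
    (expand ℤ m p).sum (fun _ c => f c) = p.sum fun _ c => f c := by
  refine (Finset.sum_nbij (· * m) (fun i hi => ?_) (fun i _ j _ h => ?_) (fun j hj => ?_)
    fun i _ => by rw [coeff_expand_mul hm]).symm
  · simpa only [mem_support_iff, coeff_expand_mul hm] using hi
  · exact Nat.eq_of_mul_eq_mul_right hm h
  · rw [Finset.mem_coe, mem_support_iff, coeff_expand hm] at hj
    obtain ⟨⟨i, rfl⟩, hi⟩ := ite_ne_right_iff.1 hj
    rw [Nat.mul_div_cancel_left i hm] at hi
    exact ⟨i, mem_support_iff.2 hi, mul_comm i m⟩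

namespace IsIrreduciblePisotUnimodular

variable {M : Matrix A A ℤ} {β : ℝ} (hM : IsIrreduciblePisotUnimodular M β)
include hM

theorem exists_roots_eq_cons : ∃ s : Multiset ℂ, (∀ a ∈ s, ‖a‖ < 1) ∧
    ((realMatrix M).map (algebraMap ℝ ℂ)).charpoly.roots = (β : ℂ) ::ₘ s := by
  rw [charpoly_map]
  have hne : (realMatrix M).charpoly ≠ 0 := (charpoly_monic _).ne_zero
  have hnodup : ((realMatrix M).charpoly.map (algebraMap ℝ ℂ)).roots.Nodup :=
    nodup_roots hM.separable_charpoly.map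
  have hβ : (β : ℂ) ∈ ((realMatrix M).charpoly.map (algebraMap ℝ ℂ)).roots :=
    mem_aroots.2 ⟨hne, aeval_algebraMap_eq_zero_iff ℂ β _ |>.2 hM.isRoot_charpoly⟩
  obtain ⟨s, hs⟩ := Multiset.exists_cons_of_mem hβ
  rw [hs, Multiset.nodup_cons] at hnodup
  refine ⟨s, fun a ha => hM.norm_lt_one ?_ (ne_of_mem_of_not_mem ha hnodup.1), hs⟩
  have haroots : a ∈ (realMatrix M).charpoly.aroots ℂ := by
    rw [aroots, hs]
    exact Multiset.mem_cons_of_mem ha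
  exact (mem_aroots.1 haroots).2

theorem exists_isDominantRelation : ∃ g, IsDominantRelation M g := by
  obtain ⟨s, hs, hroots⟩ := hM.exists_roots_eq_cons
  have hβ : 1 < ‖(β : ℂ)‖ := by
    rw [Complex.norm_of_nonneg (one_pos.trans hM.isPisot.one_lt).le]
    exact hM.isPisot.one_lt
  obtain ⟨m, hm, hdom⟩ :=
    ((eventually_gt_atTop 0).and (eventually_sum_norm_coeff_lt hβ hs)).exists
  have hchar : (M ^ m).charpoly.map (Int.castRingHom ℂ) =
      (((β : ℂ) ::ₘ s).map fun a => X - C (a ^ m)).prod := by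
    rw [← hroots, ← charpoly_pow, ← charpoly_map]
    congr 1
    have h : (realMatrix M).map (algebraMap ℝ ℂ) = (Int.castRingHom ℂ).mapMatrix M := by
      ext
      simp
    rw [h, ← map_pow]
    rfl
  have hdeg : (M ^ m).charpoly.natDegree = s.card + 1 := by
    rw [charpoly_natDegree_eq_dim, ← Multiset.card_cons (β : ℂ), ← hroots,
      ← (IsAlgClosed.splits _).natDegree_eq_card_roots, charpoly_natDegree_eq_dim]
  refine ⟨_, IsDominantRelation.of_aeval_eq_zero (p := expand ℤ m (M ^ m).charpoly)
    (k := s.card * m) ?_ ?_⟩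
  · rw [expand_aeval, aeval_self_charpoly]
  · rw [sum_expand_eq hm, coeff_expand_mul hm, sum_over_range _ fun _ => Int.natAbs_zero, hdeg]
    have h := hdom _ hchar
    simp only [coeff_map, eq_intCast, Complex.norm_intCast, ← Int.cast_abs,
      ← Nat.cast_natAbs] at h
    exact_mod_cast h

end IsIrreduciblePisotUnimodular

/-- The bound provided by the relation `g` for the bounded orbits of a matrix of norm at most `μ`,
when the errors have norm at most one. -/
def orbitBound (g : List ℤ) (μ : ℕ) : ℕ :=
  (g.map Int.natAbs).sum * (g.length * μ ^ g.length)

namespace IsDominantRelation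

variable {M : Matrix A A ℤ} {g : List ℤ} (hg : IsDominantRelation M g)
include hg

theorem sum_smul_pow_eq_zero : ∑ i ∈ Finset.range g.length, g.getD i 0 • M ^ i = 0 := by
  refine ext_of_mulVec_single fun a => ?_
  rw [zero_mulVec, ← wordValue_map_smul, hg.wordValue_eq_zero]

theorem norm_le {μ : ℕ} (hμ1 : 1 ≤ μ) (hμ : ‖realMatrix M‖ ≤ μ) {x e : ℤ → A → ℝ} {a B : ℝ}
    (hx : ∀ j, x (j + 1) = realMatrix M *ᵥ x j + e j) (he : ∀ j, ‖e j‖ ≤ a)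
    (hB : ∀ j, ‖x j‖ ≤ B) (j : ℤ) : ‖x j‖ ≤ orbitBound g μ * a := by
  have hsum : ∑ i ∈ Finset.range g.length, |((g.getD i 0 : ℤ) : ℝ)| =
      ((g.map Int.natAbs).sum : ℕ) := by
    rw [map_eq_map_range_getD]
    simp only [← Int.cast_abs, ← Nat.cast_natAbs]
    exact (Nat.cast_sum _ _).symm
  obtain ⟨c, hc, hdom⟩ := hg.dominant
  obtain ⟨k, hk, rfl⟩ := List.mem_iff_getElem.1 hc
  have hrel (v : A → ℝ) : ∑ i ∈ Finset.range g.length,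
      ((g.getD i 0 : ℤ) : ℝ) • (toLin' (realMatrix M) ^ i) v = 0 := by
    have h := congrArg (Int.castRingHom ℝ).mapMatrix hg.sum_smul_pow_eq_zero
    simp only [map_sum, map_zsmul, map_pow, map_zero] at h
    simp only [← toLin'_pow, toLin'_apply, ← smul_mulVec, ← sum_mulVec, Int.cast_smul_eq_zsmul]
    exact (congrArg (· *ᵥ v) h).trans (zero_mulVec v)
  have h := norm_le_of_dominant_relation (T := toLin' (realMatrix M)) (Nat.one_le_cast.2 hμ1)
    (fun v => (linfty_opNorm_mulVec _ v).trans (by gcongr)) hx he hB hrel (Finset.mem_range.2 hk)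
    (by
      rw [hsum, List.getD_eq_getElem _ _ hk, ← Int.cast_abs, ← Nat.cast_natAbs]
      exact_mod_cast hdom) j
  simpa only [orbitBound, hsum, Nat.cast_mul, Nat.cast_pow] using h

end IsDominantRelation

end DominantRelation

section Bounds

open Filter Topology
open scoped Matrix.Norms.Operator

variable {A : Type*} [Fintype A] [DecidableEq A] {M : Matrix A A ℤ} {β : ℝ} {R : Matrix A A ℝ}

/-- The integer vectors whose coordinates have absolute value at most `r`. -/
noncomputable def box (A : Type*) [Fintype A] [DecidableEq A] (r : ℕ) : Finset (A → ℤ) :=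
  Fintype.piFinset fun _ => Finset.Icc (-r : ℤ) r

theorem mem_box {r : ℕ} {x : A → ℤ} : x ∈ box A r ↔ ∀ i, (x i).natAbs ≤ r := by
  refine Fintype.mem_piFinset.trans (forall_congr' fun i => ?_)
  rw [Finset.mem_Icc]
  lia

theorem card_box (r : ℕ) : (box A r).card = (2 * r + 1) ^ Fintype.card A := by
  rw [box, Fintype.card_piFinset, Finset.prod_const, Int.card_Icc, Finset.card_univ]
  congr 1
  lia

theorem zero_mem_box (r : ℕ) : (0 : A → ℤ) ∈ box A r :=
  mem_box.2 fun _ => Nat.zero_le r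

theorem mem_box_iff_norm_le {r : ℕ} {x : A → ℤ} : x ∈ box A r ↔ ‖realVector x‖ ≤ r := by
  rw [mem_box, pi_norm_le_iff_of_nonneg (Nat.cast_nonneg r)]
  simp only [realVector_apply, Real.norm_eq_abs, ← Int.cast_abs, ← Nat.cast_natAbs, Nat.cast_le]

section Orbit

/-- The orbit with errors of `M` that runs through the values of the suffixes of the word `t` at
the nonpositive times and through the images of the value of `t` at the nonnegative ones,
corrected by an orbit in the range of `R` that makes it bounded. -/
noncomputable def wordOrbit (M : Matrix A A ℤ) (β : ℝ) (R : Matrix A A ℝ) (t : List (A → ℤ))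
    (j : ℤ) : A → ℝ :=
  (realMatrix M ^ j.toNat) *ᵥ realVector (wordValue M (t.drop (-j).toNat)) -
    β ^ j • (R *ᵥ realVector (wordValue M t))

theorem wordValue_drop (M : Matrix A A ℤ) (t : List (A → ℤ)) (m : ℕ) :
    wordValue M (t.drop m) = t.getD m 0 + M *ᵥ wordValue M (t.drop (m + 1)) := by
  rcases lt_or_ge m t.length with hm | hm
  · rw [List.drop_eq_getElem_cons hm, wordValue_cons, List.getD_eq_getElem _ _ hm]
  · rw [List.drop_of_length_le hm, List.drop_of_length_le (hm.trans m.le_succ),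
      List.getD_eq_default _ _ hm]
    simp

variable (hR : IsPisotSplitting M β R) {t : List (A → ℤ)}
include hR

theorem wordOrbit_natCast (i : ℕ) :
    wordOrbit M β R t i = (realMatrix M ^ i) *ᵥ ((1 - R) *ᵥ realVector (wordValue M t)) := by
  rw [sub_mulVec, one_mulVec, mulVec_sub, pow_mulVec_of_mulVec_eq_smul (hR.mulVec_mulVec _)]
  simp [wordOrbit]

theorem wordOrbit_add_one (j : ℤ) : wordOrbit M β R t (j + 1) =
    realMatrix M *ᵥ wordOrbit M β R t j +
      if j < 0 then realVector (t.getD (-(j + 1)).toNat 0) else 0 := by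
  have hβ : β ≠ 0 := (one_pos.trans hR.one_lt).ne'
  split_ifs with hj
  · have hdrop := congrArg realVector (wordValue_drop M t (-(j + 1)).toNat)
    have hsucc : (-(j + 1)).toNat + 1 = (-j).toNat := by lia
    rw [realVector_add, realVector_mulVec, hsucc] at hdrop
    rw [wordOrbit, wordOrbit, hdrop, Int.toNat_of_nonpos (by lia : j + 1 ≤ 0),
      Int.toNat_of_nonpos hj.le, mulVec_sub, mulVec_smul, hR.mulVec_mulVec, smul_smul,
      zpow_add_one₀ hβ]
    simp only [pow_zero, one_mulVec]
    abel
  · lift j to ℕ using not_lt.1 hj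
    rw [← Nat.cast_succ, wordOrbit_natCast hR, wordOrbit_natCast hR, pow_succ',
      ← mulVec_mulVec, add_zero]

theorem bddAbove_range_norm_wordOrbit (t : List (A → ℤ)) :
    BddAbove (Set.range fun j => ‖wordOrbit M β R t j‖) := by
  have hlim : Tendsto (fun i : ℕ => ‖wordOrbit M β R t i‖) atTop (𝓝 0) := by
    refine squeeze_zero (fun _ => norm_nonneg _) (fun i => ?_)
      (by simpa using hR.tendsto.mul_const ‖realVector (wordValue M t)‖)
    rw [wordOrbit_natCast hR, mulVec_mulVec]
    exact linfty_opNorm_mulVec _ _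
  have hlim' : Tendsto (fun i : ℕ => ‖wordOrbit M β R t (-i)‖) atTop (𝓝 0) := by
    have hsuffix : Tendsto (fun i : ℕ => realVector (wordValue M (t.drop i))) atTop (𝓝 0) := by
      refine tendsto_const_nhds.congr' ((eventually_ge_atTop t.length).mono fun i hi => ?_)
      simp [List.drop_of_length_le hi]
    have hpow : Tendsto (fun i : ℕ => β⁻¹ ^ i) atTop (𝓝 0) :=
      tendsto_pow_atTop_nhds_zero_of_lt_one (inv_nonneg.2 (one_pos.trans hR.one_lt).le)
        (inv_lt_one_of_one_lt₀ hR.one_lt)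
    simpa [wordOrbit] using
      (hsuffix.sub (hpow.smul_const (R *ᵥ realVector (wordValue M t)))).norm
  refine (hlim.bddAbove_range.union hlim'.bddAbove_range).mono ?_
  rintro _ ⟨j, rfl⟩
  obtain ⟨i, rfl | rfl⟩ := j.eq_nat_or_neg
  · exact Or.inl ⟨i, rfl⟩
  · exact Or.inr ⟨i, rfl⟩

end Orbit

/-- The number `K` bounds the contracting part of the values of the words with letters in a box of
radius one, and, up to the factor `β ^ |t|`, the expanding part of the value of such a word `t`. -/
structure IsValueBound (M : Matrix A A ℤ) (β : ℝ) (R : Matrix A A ℝ) (K : ℕ) : Prop where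
  contracting : ∀ (r : ℕ) (t : List (A → ℤ)), (∀ a ∈ t, a ∈ box A r) →
    ‖(1 - R) *ᵥ realVector (wordValue M t)‖ ≤ K * r
  expanding : ∀ (r : ℕ) (t : List (A → ℤ)), (∀ a ∈ t, a ∈ box A r) →
    ‖R *ᵥ realVector (wordValue M t)‖ ≤ β ^ t.length * (K * r)

theorem IsDominantRelation.norm_wordOrbit_le {g : List ℤ} (hg : IsDominantRelation M g)
    (hR : IsPisotSplitting M β R) {μ : ℕ} (hμ1 : 1 ≤ μ) (hμ : ‖realMatrix M‖ ≤ μ) {r : ℕ}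
    {t : List (A → ℤ)} (ht : ∀ a ∈ t, a ∈ box A r) (j : ℤ) :
    ‖wordOrbit M β R t j‖ ≤ orbitBound g μ * r := by
  obtain ⟨B, hB⟩ := bddAbove_range_norm_wordOrbit hR t
  refine hg.norm_le hμ1 hμ (wordOrbit_add_one hR) (fun j => ?_) (fun j => hB ⟨j, rfl⟩) j
  split_ifs
  · rw [← mem_box_iff_norm_le]
    rcases lt_or_ge (-(j + 1)).toNat t.length with hj | hj
    · rw [List.getD_eq_getElem _ _ hj]
      exact ht _ (List.getElem_mem hj)
    · rw [List.getD_eq_default _ _ hj]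
      exact zero_mem_box r
  · simp

theorem IsDominantRelation.isValueBound {g : List ℤ} (hg : IsDominantRelation M g)
    (hR : IsPisotSplitting M β R) {μ : ℕ} (hμ1 : 1 ≤ μ) (hμ : ‖realMatrix M‖ ≤ μ) :
    IsValueBound M β R (orbitBound g μ) where
  contracting r t ht := by
    have h := hg.norm_wordOrbit_le hR hμ1 hμ ht (0 : ℕ)
    rwa [wordOrbit_natCast hR, pow_zero, one_mulVec] at h
  expanding r t ht := by
    have hβ : 0 < β := one_pos.trans hR.one_lt
    have h := hg.norm_wordOrbit_le hR hμ1 hμ ht (-t.length)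
    rwa [wordOrbit, neg_neg, Int.toNat_natCast, List.drop_length, wordValue_nil, realVector_zero,
      mulVec_zero, zero_sub, norm_neg, norm_smul,
      Real.norm_of_nonneg (by positivity), _root_.zpow_neg, zpow_natCast,
      inv_mul_le_iff₀ (by positivity)] at h

section Rounding

/-- The coordinatewise rounding of a real vector. -/
noncomputable def roundVector {A : Type*} (y : A → ℝ) : A → ℤ := fun i => round (y i)

omit [DecidableEq A] in
theorem norm_realVector_roundVector_sub_le (y : A → ℝ) :
    ‖realVector (roundVector y) - y‖ ≤ 1 / 2 := by
  refine (pi_norm_le_iff_of_nonneg (by norm_num)).2 fun i => ?_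
  rw [Pi.sub_apply, norm_sub_rev]
  exact abs_sub_round _

omit [DecidableEq A] in
theorem roundVector_eq_of_norm_lt {y : A → ℝ} {z : A → ℤ} (h : ‖realVector z - y‖ < 1 / 2) :
    roundVector y = z := by
  ext i
  have hi : |z i - y i| < 1 / 2 := (norm_le_pi_norm _ i).trans_lt h
  rw [abs_lt] at hi
  rw [roundVector, round_eq, Int.floor_eq_iff]
  constructor <;> linarith

theorem exists_wordValue_eq_of_forall_mem {B : Set (A → ℤ)} {Z : ℕ → A → ℤ}
    (hB : ∀ j, Z j - M *ᵥ Z (j + 1) ∈ B) {n : ℕ} (hn : Z n = 0) :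
    ∃ w : List (A → ℤ), (∀ a ∈ w, a ∈ B) ∧ wordValue M w = Z 0 := by
  refine ⟨(List.range n).map fun j => Z j - M *ᵥ Z (j + 1), fun a ha => ?_, ?_⟩
  · obtain ⟨j, _, rfl⟩ := List.mem_map.1 ha
    exact hB j
  · rw [wordValue_map_range]
    simp only [mulVec_sub, mulVec_mulVec, ← pow_succ]
    rw [Finset.sum_range_sub' fun j => (M ^ j) *ᵥ Z j, hn]
    simp

/-- The word is read off from the rounded images of the expanding part of `z` under the negative
powers of `M`. -/
theorem IsPisotSplitting.exists_wordValue_eq (hR : IsPisotSplitting M β R) {μ : ℕ} (hμ1 : 1 ≤ μ)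
    (hμ : ‖realMatrix M‖ ≤ μ) {z : A → ℤ} (hz : ‖(1 - R) *ᵥ realVector z‖ < 1 / 2) :
    ∃ w : List (A → ℤ), (∀ a ∈ w, a ∈ box A μ) ∧ wordValue M w = z := by
  have hβ : 0 < β := one_pos.trans hR.one_lt
  set y : ℕ → A → ℝ := fun j => β⁻¹ ^ j • (R *ᵥ realVector z) with hy
  have hMy (j : ℕ) : realMatrix M *ᵥ y (j + 1) = y j := by
    simp only [hy, mulVec_smul, hR.mulVec_mulVec, smul_smul, pow_succ,
      inv_mul_cancel_right₀ hβ.ne']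
  have hstart : roundVector (y 0) = z := by
    refine roundVector_eq_of_norm_lt ?_
    simpa [hy, sub_mulVec] using hz
  have hlim : Tendsto y atTop (𝓝 0) := by
    simpa [hy] using (tendsto_pow_atTop_nhds_zero_of_lt_one (inv_nonneg.2 hβ.le)
      (inv_lt_one_of_one_lt₀ hR.one_lt)).smul_const (R *ᵥ realVector z)
  obtain ⟨n, hn⟩ := (hlim.norm.eventually_lt_const (u := 1 / 2) (by simp)).exists
  have hend : roundVector (y n) = 0 := by
    refine roundVector_eq_of_norm_lt ?_
    rwa [realVector_zero, zero_sub, norm_neg]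
  rw [← hstart]
  refine exists_wordValue_eq_of_forall_mem (B := box A μ) (Z := fun j => roundVector (y j))
    (fun j => mem_box_iff_norm_le.2 ?_) hend
  have hsub : realVector (roundVector (y j) - M *ᵥ roundVector (y (j + 1))) =
      (realVector (roundVector (y j)) - y j) -
        realMatrix M *ᵥ (realVector (roundVector (y (j + 1))) - y (j + 1)) := by
    rw [mulVec_sub, hMy, ← realVector_mulVec, sub_sub_sub_cancel_right, realVector_sub]
  have hμ1' : (1 : ℝ) ≤ μ := Nat.one_le_cast.2 hμ1
  calc ‖realVector (roundVector (y j) - M *ᵥ roundVector (y (j + 1)))‖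
      ≤ 1 / 2 + μ * (1 / 2) := by
        rw [hsub]
        refine (norm_sub_le _ _).trans (add_le_add (norm_realVector_roundVector_sub_le _)
          ((linfty_opNorm_mulVec _ _).trans ?_))
        gcongr
        exact norm_realVector_roundVector_sub_le _
    _ ≤ μ := by linarith

end Rounding

end Bounds

section Trap

variable {A : Type*} [Fintype A] [DecidableEq A] {M : Matrix A A ℤ} {β : ℝ} {R : Matrix A A ℝ}
  {K r b : ℕ}

/-- The finite set `T` is a trap for the Horner recursion of `wordValue`: starting from `0` and
adding letters of the box of radius `r`, the value stays in `T` until all its coordinates are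
larger than `b`. -/
structure IsTrap (M : Matrix A A ℤ) (r b : ℕ) (T : Finset (A → ℤ)) : Prop where
  zero_mem : 0 ∈ T
  step : ∀ h ∈ T, ∀ x ∈ box A r, x + M *ᵥ h ∈ T ∨ ∀ i, b < ((x + M *ᵥ h) i).natAbs

theorem IsTrap.mem_or_exists_suffix {T : Finset (A → ℤ)} (hT : IsTrap M r b T)
    {w : List (A → ℤ)} (hw : ∀ a ∈ w, a ∈ box A r) :
    wordValue M w ∈ T ∨ ∃ w₁ w₂, w = w₁ ++ w₂ ∧ ∀ i, b < (wordValue M w₂ i).natAbs := by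
  induction w with
  | nil => exact Or.inl (by simpa using hT.zero_mem)
  | cons x w ih =>
    rw [List.forall_mem_cons] at hw
    rcases ih hw.2 with h | ⟨w₁, w₂, rfl, h⟩
    · rw [wordValue_cons]
      exact (hT.step _ h x hw.1).imp_right fun h' => ⟨[], x :: w, rfl, by simpa using h'⟩
    · exact Or.inr ⟨x :: w₁, w₂, rfl, h⟩

theorem IsIrreduciblePisotUnimodular.exists_norm_le_mul_abs_apply
    (hM : IsIrreduciblePisotUnimodular M β) :
    ∃ c : ℝ, 0 ≤ c ∧ ∀ w : A → ℝ, realMatrix M *ᵥ w = β • w → ∀ i, ‖w‖ ≤ c * |w i| := by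
  have hmem (w : A → ℝ) : w ∈ realEigenspace M β ↔ realMatrix M *ᵥ w = β • w := by
    simp [realEigenspace]
  have hcoord (i : A) : ∃ c : NNReal, ∀ w ∈ realEigenspace M β, ‖w‖ ≤ c * |w i| := by
    let f : realEigenspace M β →ₗ[ℝ] ℝ := (LinearMap.proj i).comp (realEigenspace M β).subtype
    have hf : LinearMap.ker f = ⊥ := LinearMap.ker_eq_bot'.2 fun w hw =>
      Subtype.ext (hM.eq_zero_of_apply_eq_zero ((hmem w).1 w.2) hw)
    obtain ⟨c, _, hc⟩ := f.exists_antilipschitzWith hf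
    exact ⟨c, fun w hw => by simpa [f] using hc.le_mul_norm_sub ⟨w, hw⟩ 0⟩
  choose c hc using hcoord
  refine ⟨∑ i, c i, by positivity, fun w hw i => (hc i w ((hmem w).2 hw)).trans ?_⟩
  gcongr
  exact Finset.single_le_sum (f := fun i => (c i : ℝ)) (fun _ _ => NNReal.coe_nonneg _)
    (Finset.mem_univ i)

theorem IsValueBound.finite_setOf_exists_natAbs_le (hK : IsValueBound M β R K)
    (hM : IsIrreduciblePisotUnimodular M β) (hR : IsPisotSplitting M β R) (r b : ℕ) :
    {h : A → ℤ | (∃ t, (∀ a ∈ t, a ∈ box A r) ∧ wordValue M t = h) ∧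
      ∃ i, (h i).natAbs ≤ b}.Finite := by
  obtain ⟨c, hc0, hc⟩ := hM.exists_norm_le_mul_abs_apply
  refine (box A ⌈(K * r : ℝ) + c * (b + K * r)⌉₊).finite_toSet.subset ?_
  rintro _ ⟨⟨t, ht, rfl⟩, i, hi⟩
  refine mem_box_iff_norm_le.2 (le_trans ?_ (Nat.le_ceil _))
  set x := realVector (wordValue M t) with hx
  have hsplit : x = (1 - R) *ᵥ x + R *ᵥ x := by rw [sub_mulVec, one_mulVec, sub_add_cancel]
  have hcontr : ‖(1 - R) *ᵥ x‖ ≤ K * r := hK.contracting r t ht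
  have hcoord : |(R *ᵥ x) i| ≤ b + K * r := by
    have hxi : |x i| ≤ b := by
      rw [hx, realVector_apply, ← Int.cast_abs, ← Nat.cast_natAbs]
      exact_mod_cast hi
    have hRi : (R *ᵥ x) i = x i - ((1 - R) *ᵥ x) i :=
      eq_sub_of_add_eq' (congrFun hsplit i).symm
    rw [hRi]
    exact (abs_sub _ _).trans (add_le_add hxi ((norm_le_pi_norm _ i).trans hcontr))
  calc ‖x‖ ≤ ‖(1 - R) *ᵥ x‖ + ‖R *ᵥ x‖ := by
        conv_lhs => rw [hsplit]
        exact norm_add_le _ _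
    _ ≤ K * r + c * (b + K * r) := by
        gcongr
        exact (hc _ (hR.mulVec_mulVec x) i).trans (by gcongr)

theorem IsValueBound.exists_isTrap (hK : IsValueBound M β R K)
    (hM : IsIrreduciblePisotUnimodular M β) (hR : IsPisotSplitting M β R) (r b : ℕ) :
    ∃ T, IsTrap M r b T := by
  obtain ⟨i⟩ := hM.nonempty
  have hfin := hK.finite_setOf_exists_natAbs_le hM hR r b
  refine ⟨hfin.toFinset, ?_, fun h hh x hx => ?_⟩
  · rw [Set.Finite.mem_toFinset]
    exact ⟨⟨[], by simp⟩, i, by simp⟩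
  · rw [Set.Finite.mem_toFinset] at hh ⊢
    obtain ⟨⟨t, ht, rfl⟩, -⟩ := hh
    rw [← not_exists_not]
    simp only [not_lt]
    exact (em _).imp_left fun hsmall =>
      ⟨⟨x :: t, List.forall_mem_cons.2 ⟨hx, ht⟩, wordValue_cons M x t⟩, hsmall⟩

end Trap

section NonnegWords

variable {A : Type*} [Fintype A] [DecidableEq A] {M : Matrix A A ℤ} {β : ℝ} {R : Matrix A A ℝ}
  {K r : ℕ}

/-- The words with letters in a box whose value has nonnegative coordinates. -/
def nonnegWords (M : Matrix A A ℤ) (r : ℕ) : Language (A → ℤ) :=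
  {t | (∀ a ∈ t, a ∈ box A r) ∧ ∀ i, 0 ≤ wordValue M t i}

/-- The state map of `nonnegWords` given by a trap `T`: it records which elements of `T`, as values
of the continuation, make the total value nonnegative. -/
def nonnegState (M : Matrix A A ℤ) (r : ℕ) (T : Finset (A → ℤ)) (s : List (A → ℤ)) :
    Prop × Set T :=
  (∀ a ∈ s, a ∈ box A r, {h | ∀ i, 0 ≤ (wordValue M s + (M ^ s.length) *ᵥ (h : A → ℤ)) i})

/-- The expanding part of the value of `t` dominates both contracting parts, so that the values of
`t` and `s ++ t` have the same sign at `i`. -/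
theorem IsValueBound.nonneg_append_iff (hK : IsValueBound M β R K)
    (hR : IsPisotSplitting M β R) {s t : List (A → ℤ)} (hs : ∀ a ∈ s, a ∈ box A r)
    (ht : ∀ a ∈ t, a ∈ box A r) {i : A} (hi : 3 * K * r < (wordValue M t i).natAbs) :
    0 ≤ wordValue M (s ++ t) i ↔ 0 ≤ wordValue M t i := by
  have hcontr {u : List (A → ℤ)} (hu : ∀ a ∈ u, a ∈ box A r) :
      |wordValue M u i - (R *ᵥ realVector (wordValue M u)) i| ≤ K * r := by
    simpa only [sub_mulVec, one_mulVec, Real.norm_eq_abs, Pi.sub_apply, realVector_apply] using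
      (norm_le_pi_norm _ i).trans (hK.contracting r u hu)
  have happend := abs_le.1 (hcontr (List.forall_mem_append.2 ⟨hs, ht⟩))
  have htail := abs_le.1 (hcontr ht)
  have hhead := abs_le.1 ((norm_le_pi_norm _ i).trans (hK.expanding r s hs))
  have hexpand : (R *ᵥ realVector (wordValue M (s ++ t))) i =
      (R *ᵥ realVector (wordValue M s)) i +
        β ^ s.length * (R *ᵥ realVector (wordValue M t)) i := by
    rw [wordValue_append, realVector_add, mulVec_add, realVector_pow_mulVec,
      hR.mulVec_pow_mulVec]
    rfl
  have hb : 1 ≤ β ^ s.length := one_le_pow₀ hR.one_lt.le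
  have hk : (0 : ℝ) ≤ K * r := by positivity
  have hi' : 3 * (K * r) < |(wordValue M t i : ℝ)| := by
    rw [← Int.cast_abs, ← Nat.cast_natAbs, ← mul_assoc]
    exact_mod_cast hi
  rw [hexpand] at happend
  rw [← Int.cast_nonneg_iff (R := ℝ), ← Int.cast_nonneg_iff (R := ℝ)]
  rcases lt_or_ge (wordValue M t i : ℝ) 0 with hneg | hpos
  · rw [abs_of_neg hneg] at hi'
    refine iff_of_false ?_ hneg.not_ge
    nlinarith
  · rw [abs_of_nonneg hpos] at hi'
    refine iff_of_true ?_ hpos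
    nlinarith

theorem isStateMap_nonnegState (hK : IsValueBound M β R K) (hR : IsPisotSplitting M β R)
    {T : Finset (A → ℤ)} (hT : IsTrap M r (3 * K * r) T) :
    IsStateMap (nonnegState M r T) (nonnegWords M r) := by
  intro u v huv w
  have hbox : (∀ a ∈ u, a ∈ box A r) ↔ ∀ a ∈ v, a ∈ box A r := iff_of_eq (Prod.ext_iff.1 huv).1
  have hsign := Set.ext_iff.1 (Prod.ext_iff.1 huv).2
  change (_ ∧ _) ↔ (_ ∧ _)
  rw [List.forall_mem_append, List.forall_mem_append, ← hbox]
  refine and_congr_right fun ⟨hu, hw⟩ => ?_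
  have hv := hbox.1 hu
  rcases hT.mem_or_exists_suffix hw with h | ⟨w₁, w₂, rfl, h⟩
  · rw [wordValue_append, wordValue_append]
    exact hsign ⟨_, h⟩
  · rw [List.forall_mem_append] at hw
    refine forall_congr' fun i => ?_
    rw [← List.append_assoc, ← List.append_assoc,
      hK.nonneg_append_iff hR (List.forall_mem_append.2 ⟨hu, hw.1⟩) hw.2 (h i),
      hK.nonneg_append_iff hR (List.forall_mem_append.2 ⟨hv, hw.1⟩) hw.2 (h i)]

end NonnegWords

section ValueWords

variable {A : Type*} [Fintype A] [DecidableEq A] {M : Matrix A A ℤ} {β : ℝ} {R : Matrix A A ℝ}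
  {K r : ℕ} {L : Language (A → ℤ)}

/-- The words with letters in a box whose value is the value of a word of `L` that is not
longer. -/
def valueWords (M : Matrix A A ℤ) (r : ℕ) (L : Language (A → ℤ)) : Language (A → ℤ) :=
  {t | (∀ a ∈ t, a ∈ box A r) ∧ ∃ v ∈ L, v.length ≤ t.length ∧ wordValue M v = wordValue M t}

theorem mem_padClosure_valueWords {t : List (A → ℤ)} :
    t ∈ padClosure 0 (valueWords M r L) ↔
      (∀ a ∈ t, a ∈ box A r) ∧ wordValue M t ∈ languageValue M L := by
  have hpad (k : ℕ) : wordValue M (t ++ List.replicate k 0) = wordValue M t := by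
    rw [wordValue_append, wordValue_replicate_zero, mulVec_zero, add_zero]
  constructor
  · rintro ⟨k, hbox, v, hv, -, hval⟩
    exact ⟨(List.forall_mem_append.1 hbox).1, v, hv, hval.trans (hpad k)⟩
  · rintro ⟨hbox, v, hv, hval⟩
    refine ⟨v.length, List.forall_mem_append.2 ⟨hbox, fun a ha => ?_⟩, v, hv, by simp,
      hval.trans (hpad _).symm⟩
    exact List.eq_of_mem_replicate ha ▸ zero_mem_box r

/-- The state map of `valueWords` given by a state map `κ` of `L`: it records the differences of
value that a word with letters in the box, of the same length and in a given state of `κ`, can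
have with `s`, and those that a word of `L` that is not longer can have. -/
def valueState {C : Type*} (κ : List (A → ℤ) → C) (M : Matrix A A ℤ) (r b : ℕ)
    (L : Language (A → ℤ)) (s : List (A → ℤ)) : Prop × Set (C × box A b) × Set (box A b) :=
  (∀ a ∈ s, a ∈ box A r,
    {q | ∃ v : List (A → ℤ), v.length = s.length ∧ (∀ a ∈ v, a ∈ box A r) ∧ κ v = q.1 ∧
      wordValue M v = wordValue M s + (M ^ s.length) *ᵥ (q.2 : A → ℤ)},
    {e | ∃ v ∈ L, v.length ≤ s.length ∧
      wordValue M v = wordValue M s + (M ^ s.length) *ᵥ (e : A → ℤ)})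

/-- The contracting part of the difference is bounded because both `t` and `x` have letters in the
box, and its expanding part because both `s` and `v` have. -/
theorem IsValueBound.sub_mem_box (hK : IsValueBound M β R K) (hR : IsPisotSplitting M β R)
    {s v t x : List (A → ℤ)} (hs : ∀ a ∈ s, a ∈ box A r) (hv : ∀ a ∈ v, a ∈ box A r)
    (ht : ∀ a ∈ t, a ∈ box A r) (hx : ∀ a ∈ x, a ∈ box A r) (hlen : v.length ≤ s.length)
    (h : wordValue M v = wordValue M s + (M ^ s.length) *ᵥ (wordValue M t - wordValue M x)) :
    wordValue M t - wordValue M x ∈ box A (4 * K * r) := by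
  set e := wordValue M t - wordValue M x with he
  have hcontr : ‖(1 - R) *ᵥ realVector e‖ ≤ K * r + K * r := by
    rw [he, realVector_sub, mulVec_sub]
    exact (norm_sub_le _ _).trans (add_le_add (hK.contracting r t ht) (hK.contracting r x hx))
  have hexpand : ‖R *ᵥ realVector e‖ ≤ K * r + K * r := by
    have hb : 0 < β ^ s.length := pow_pos (one_pos.trans hR.one_lt) _
    have hval : β ^ s.length • (R *ᵥ realVector e) =
        R *ᵥ realVector (wordValue M v) - R *ᵥ realVector (wordValue M s) := by
      rw [h, realVector_add, mulVec_add, realVector_pow_mulVec, hR.mulVec_pow_mulVec,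
        add_sub_cancel_left]
    refine le_of_mul_le_mul_left ?_ hb
    calc β ^ s.length * ‖R *ᵥ realVector e‖
        = ‖R *ᵥ realVector (wordValue M v) - R *ᵥ realVector (wordValue M s)‖ := by
          rw [← hval, norm_smul, Real.norm_of_nonneg hb.le]
      _ ≤ β ^ v.length * (K * r) + β ^ s.length * (K * r) :=
          (norm_sub_le _ _).trans (add_le_add (hK.expanding r v hv) (hK.expanding r s hs))
      _ ≤ β ^ s.length * (K * r) + β ^ s.length * (K * r) := by
          gcongr
          exact hR.one_lt.le
      _ = β ^ s.length * (K * r + K * r) := by ring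
  rw [mem_box_iff_norm_le]
  calc ‖realVector e‖ = ‖(1 - R) *ᵥ realVector e + R *ᵥ realVector e‖ := by
        rw [sub_mulVec, one_mulVec, sub_add_cancel]
    _ ≤ (K * r + K * r) + (K * r + K * r) := norm_add_le_of_le hcontr hexpand
    _ = (4 * K * r : ℕ) := by
        push_cast
        ring

theorem exists_wordValue_append_eq_of_valueState_eq {C : Type*} {κ : List (A → ℤ) → C}
    (hK : IsValueBound M β R K) (hR : IsPisotSplitting M β R) (hκ : IsStateMap κ L)
    (hL : ∀ u ∈ L, ∀ a ∈ u, a ∈ box A r) {u v w x : List (A → ℤ)} (hu : ∀ a ∈ u, a ∈ box A r)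
    (hw : ∀ a ∈ w, a ∈ box A r)
    (huv : (valueState κ M r (4 * K * r) L u).2 = (valueState κ M r (4 * K * r) L v).2)
    (hx : x ∈ L) (hlen : x.length ≤ (u ++ w).length) (hxw : wordValue M x = wordValue M (u ++ w)) :
    ∃ y ∈ L, y.length ≤ (v ++ w).length ∧ wordValue M y = wordValue M (v ++ w) := by
  obtain ⟨hlong, hshort⟩ := Prod.ext_iff.1 huv
  rw [wordValue_append] at hxw
  rcases le_total x.length u.length with hxu | hxu
  · have hmem : wordValue M w ∈ box A (4 * K * r) := by
      simpa using hK.sub_mem_box hR hu (hL x hx) hw (x := []) (by simp) hxu (by simpa using hxw)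
    obtain ⟨y, hy, hyl, hyw⟩ := (Set.ext_iff.1 hshort ⟨_, hmem⟩).1 ⟨x, hx, hxu, hxw⟩
    exact ⟨y, hy, by rw [List.length_append]; lia, by rw [hyw, wordValue_append]⟩
  · obtain ⟨x₁, x₂, rfl, hx₁⟩ : ∃ x₁ x₂, x = x₁ ++ x₂ ∧ x₁.length = u.length :=
      ⟨x.take u.length, x.drop u.length, (List.take_append_drop _ _).symm, by simpa using hxu⟩
    obtain ⟨hb₁, hb₂⟩ := List.forall_mem_append.1 (hL _ hx)
    have heq : wordValue M x₁ =
        wordValue M u + (M ^ u.length) *ᵥ (wordValue M w - wordValue M x₂) := by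
      rw [wordValue_append, hx₁] at hxw
      rw [mulVec_sub, add_sub, ← hxw, add_sub_cancel_right]
    obtain ⟨y, hyl, _, hκy, hy⟩ :=
      (Set.ext_iff.1 hlong (κ x₁, ⟨_, hK.sub_mem_box hR hu hb₁ hw hb₂ hx₁.le heq⟩)).1
        ⟨x₁, hx₁, hb₁, rfl, heq⟩
    refine ⟨y ++ x₂, (hκ hκy x₂).2 hx, ?_, ?_⟩
    · simp only [List.length_append] at hlen ⊢
      lia
    · rw [wordValue_append, hyl, hy, wordValue_append, mulVec_sub]
      abel

theorem isStateMap_valueState {C : Type*} {κ : List (A → ℤ) → C} (hK : IsValueBound M β R K)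
    (hR : IsPisotSplitting M β R) (hκ : IsStateMap κ L) (hL : ∀ u ∈ L, ∀ a ∈ u, a ∈ box A r) :
    IsStateMap (valueState κ M r (4 * K * r) L) (valueWords M r L) := by
  suffices H : ∀ {u v}, valueState κ M r (4 * K * r) L u = valueState κ M r (4 * K * r) L v →
      ∀ {w}, u ++ w ∈ valueWords M r L → v ++ w ∈ valueWords M r L from
    fun u v huv w => ⟨H huv, H huv.symm⟩
  rintro u v huv w ⟨hbox, x, hx, hlen, hxw⟩
  obtain ⟨hu, hw⟩ := List.forall_mem_append.1 hbox
  obtain ⟨hboxuv, hval⟩ := Prod.ext_iff.1 huv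
  have hv : ∀ a ∈ v, a ∈ box A r := (iff_of_eq hboxuv).1 hu
  exact ⟨List.forall_mem_append.2 ⟨hv, hw⟩,
    exists_wordValue_append_eq_of_valueState_eq hK hR hκ hL hu hw hval hx hlen hxw⟩

end ValueWords

section Interior

open Filter Topology
open scoped Matrix.Norms.Operator

variable {A : Type*}

theorem mem_discreteInterior_iff {P : Submodule ℝ (A → ℝ)} {π : (A → ℝ) →ₗ[ℝ] P}
    {S : Set (A → ℤ)} {x : A → ℤ} :
    x ∈ discreteInterior π S ↔ (∀ i, 0 ≤ x i) ∧ ∃ U : Set P, IsOpen U ∧ π (realVector x) ∈ U ∧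
      ∀ y : A → ℤ, (∀ i, 0 ≤ y i) → π (realVector y) ∈ U → y ∈ S := by
  constructor
  · rintro ⟨V, ⟨⟨U, hU, rfl⟩, hV⟩, hx⟩
    exact ⟨hx.1, U, hU, hx.2, fun y hy hyU => hV ⟨hy, hyU⟩⟩
  · rintro ⟨hx, U, hU, hxU, h⟩
    exact ⟨_, ⟨⟨U, hU, rfl⟩, fun y hy => h y hy.1 hy.2⟩, hx, hxU⟩

theorem discreteInterior_subset {P : Submodule ℝ (A → ℝ)} (π : (A → ℝ) →ₗ[ℝ] P)
    (S : Set (A → ℤ)) : discreteInterior π S ⊆ S :=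
  Set.sUnion_subset fun _ hV => hV.2

variable [Fintype A] [DecidableEq A] {M : Matrix A A ℤ} {β : ℝ} {R : Matrix A A ℝ} {K r : ℕ}
  {L : Language (A → ℤ)}

theorem languageValue_interiorLanguage (M : Matrix A A ℤ) {P : Submodule ℝ (A → ℝ)}
    (π : (A → ℝ) →ₗ[ℝ] P) (L : Language (A → ℤ)) :
    languageValue M (interiorLanguage M π L) = discreteInterior π (languageValue M L) := by
  ext x
  constructor
  · rintro ⟨u, hu, rfl⟩
    exact hu.2
  · intro hx
    obtain ⟨u, hu, rfl⟩ := discreteInterior_subset _ _ hx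
    exact ⟨u, ⟨hu, hx⟩, rfl⟩

theorem IsPisotSplitting.one_sub_mulVec_eq_zero_iff (hR : IsPisotSplitting M β R) {v : A → ℝ} :
    (1 - R) *ᵥ v = 0 ↔ v ∈ realEigenspace M β := by
  rw [sub_mulVec, one_mulVec, sub_eq_zero, realEigenspace, Module.End.mem_eigenspace_iff,
    toLin'_apply]
  refine ⟨fun h => ?_, fun h => (hR.mulVec_eq_self v h).symm⟩
  rw [h]
  exact hR.mulVec_mulVec v

/-- The contracting part serves as a coordinate on the hyperplane, whatever this hyperplane. -/
theorem IsPisotSplitting.mem_discreteInterior_projectionOnto_iff (hR : IsPisotSplitting M β R)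
    {P : Submodule ℝ (A → ℝ)} (hP : IsCompl P (realEigenspace M β)) {S : Set (A → ℤ)}
    {x : A → ℤ} :
    x ∈ discreteInterior (P.projectionOnto (realEigenspace M β) hP) S ↔
      (∀ i, 0 ≤ x i) ∧ ∃ ε > 0, ∀ y : A → ℤ, (∀ i, 0 ≤ y i) →
        ‖(1 - R) *ᵥ realVector (y - x)‖ < ε → y ∈ S := by
  rw [mem_discreteInterior_iff]
  refine and_congr_right fun _ => ?_
  set π := P.projectionOnto (realEigenspace M β) hP
  have hπ_one_sub (v : A → ℝ) : π ((1 - R) *ᵥ v) = π v := by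
    rw [← sub_eq_zero, ← map_sub, Submodule.projectionOnto_apply_eq_zero_iff,
      ← hR.one_sub_mulVec_eq_zero_iff, mulVec_sub, Matrix.mulVec_mulVec,
      hR.isIdempotentElem.one_sub.eq, sub_self]
  have hone_sub_π (v : A → ℝ) : (1 - R) *ᵥ (π v : A → ℝ) = (1 - R) *ᵥ v := by
    rw [← sub_eq_zero, ← mulVec_sub, hR.one_sub_mulVec_eq_zero_iff,
      ← Submodule.projectionOnto_apply_eq_zero_iff hP, map_sub,
      Submodule.projectionOnto_apply_left, sub_self]
  constructor
  · rintro ⟨U, hU, hxU, hUS⟩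
    have hcont : Continuous fun v => π (realVector x + v) := by
      have := π.continuous_of_finiteDimensional
      fun_prop
    obtain ⟨ε, hε, hball⟩ := Metric.isOpen_iff.1 (hU.preimage hcont) 0 (by simpa using hxU)
    refine ⟨ε, hε, fun y hy hyx => hUS y hy ?_⟩
    have hπy : π (realVector x + (1 - R) *ᵥ realVector (y - x)) = π (realVector y) := by
      rw [map_add, hπ_one_sub, realVector_sub, map_sub, add_sub_cancel]
    rw [← hπy]
    exact hball (mem_ball_zero_iff.2 hyx)
  · rintro ⟨ε, hε, h⟩
    refine ⟨{p | ‖(1 - R) *ᵥ ((p : A → ℝ) - realVector x)‖ < ε},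
      isOpen_lt (by fun_prop) continuous_const, ?_, fun y hy hyU => h y hy ?_⟩
    · simpa [mulVec_sub, hone_sub_π] using hε
    · simpa [mulVec_sub, hone_sub_π, realVector_sub] using hyU

theorem wordValue_append_replicate_append (M : Matrix A A ℤ) (u w : List (A → ℤ)) (m : ℕ) :
    wordValue M (u ++ List.replicate m 0 ++ w) =
      wordValue M u + (M ^ (u.length + m)) *ᵥ wordValue M w := by
  simp [wordValue_append, pow_add]

theorem IsPisotSplitting.one_sub_mulVec_pow_mulVec (hR : IsPisotSplitting M β R) (k : ℕ)
    (v : A → ℝ) :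
    (1 - R) *ᵥ ((realMatrix M ^ k) *ᵥ v) = (realMatrix M ^ k) *ᵥ ((1 - R) *ᵥ v) := by
  rw [Matrix.mulVec_mulVec, Matrix.mulVec_mulVec, (hR.commute_one_sub.pow_left k).eq]

theorem IsValueBound.exists_forall_append_mem (hK : IsValueBound M β R K)
    (hR : IsPisotSplitting M β R) {S : Set (A → ℤ)} {u : List (A → ℤ)} {ε : ℝ} (hε : 0 < ε)
    (h : ∀ y : A → ℤ, (∀ i, 0 ≤ y i) →
      ‖(1 - R) *ᵥ realVector (y - wordValue M u)‖ < ε → y ∈ S) (r : ℕ) :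
    ∃ m, ∀ w : List (A → ℤ), (∀ a ∈ w, a ∈ box A r) →
      (∀ i, 0 ≤ wordValue M (u ++ List.replicate m 0 ++ w) i) →
      wordValue M (u ++ List.replicate m 0 ++ w) ∈ S := by
  have hc : (0 : ℝ) < K * r + 1 := by positivity
  obtain ⟨m, hm⟩ := eventually_atTop.1 (hR.eventually_norm_pow_mulVec_le (div_pos hε hc))
  refine ⟨m, fun w hw hnonneg => h _ hnonneg ?_⟩
  set x := (1 - R) *ᵥ realVector (wordValue M w) with hx
  have hidem : (1 - R) *ᵥ x = x := by
    rw [hx, Matrix.mulVec_mulVec, hR.isIdempotentElem.one_sub.eq]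
  rw [wordValue_append_replicate_append, add_sub_cancel_left, realVector_pow_mulVec,
    hR.one_sub_mulVec_pow_mulVec]
  calc ‖(realMatrix M ^ (u.length + m)) *ᵥ x‖ ≤ ε / (K * r + 1) * ‖x‖ := by
        simpa only [hidem] using hm (u.length + m) (Nat.le_add_left _ _) x
    _ ≤ ε / (K * r + 1) * (K * r) := by
        gcongr
        exact hK.contracting r w hw
    _ < ε / (K * r + 1) * (K * r + 1) := by
        gcongr
        exact lt_add_one _
    _ = ε := div_mul_cancel₀ ε hc.ne'

/-- A vector close to `x` modulo the expanding line is `x + M ^ k z` for a vector `z` close to this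
line, and such a vector `z` is the value of a word. -/
theorem IsPisotSplitting.exists_forall_eq_wordValue_append (hR : IsPisotSplitting M β R)
    (hdet : IsUnit M.det) {μ : ℕ} (hμ1 : 1 ≤ μ) (hμ : ‖realMatrix M‖ ≤ μ) (u : List (A → ℤ))
    (m : ℕ) :
    ∃ ε > 0, ∀ y : A → ℤ, ‖(1 - R) *ᵥ realVector (y - wordValue M u)‖ < ε →
      ∃ w : List (A → ℤ), (∀ a ∈ w, a ∈ box A μ) ∧
        wordValue M (u ++ List.replicate m 0 ++ w) = y := by
  set k := u.length + m
  have hdetk : IsUnit (M ^ k).det := by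
    rw [det_pow]
    exact hdet.pow k
  have hinv : realMatrix (M ^ k)⁻¹ * realMatrix M ^ k = 1 := by
    rw [← realMatrix_pow]
    exact (Matrix.map_mul (f := Int.castRingHom ℝ)).symm.trans
      ((congrArg realMatrix (nonsing_inv_mul _ hdetk)).trans (by simp))
  set C := ‖realMatrix (M ^ k)⁻¹‖
  refine ⟨1 / 2 / (C + 1), by positivity, fun y hy => ?_⟩
  set z := (M ^ k)⁻¹ *ᵥ (y - wordValue M u) with hz
  have hMz : (M ^ k) *ᵥ z = y - wordValue M u := by
    rw [hz, Matrix.mulVec_mulVec, mul_nonsing_inv _ hdetk, one_mulVec]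
  have hzeq : (1 - R) *ᵥ realVector z =
      realMatrix (M ^ k)⁻¹ *ᵥ ((1 - R) *ᵥ realVector (y - wordValue M u)) := by
    rw [← hMz, realVector_pow_mulVec, hR.one_sub_mulVec_pow_mulVec,
      Matrix.mulVec_mulVec _ _ (_ ^ _), hinv, one_mulVec]
  obtain ⟨w, hw, hwz⟩ := hR.exists_wordValue_eq hμ1 hμ (z := z) <| by
    calc ‖(1 - R) *ᵥ realVector z‖
        ≤ C * ‖(1 - R) *ᵥ realVector (y - wordValue M u)‖ := by
          rw [hzeq]
          exact linfty_opNorm_mulVec _ _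
      _ ≤ C * (1 / 2 / (C + 1)) := by gcongr
      _ < (C + 1) * (1 / 2 / (C + 1)) := by
          gcongr
          exact lt_add_one C
      _ = 1 / 2 := mul_div_cancel₀ _ (by positivity)
  refine ⟨w, hw, ?_⟩
  rw [wordValue_append_replicate_append, hwz, hMz, add_sub_cancel]

theorem forall_mem_append_replicate_append {u w : List (A → ℤ)}
    (hu : ∀ a ∈ u, a ∈ box A r) (hw : ∀ a ∈ w, a ∈ box A r) (m : ℕ) :
    ∀ a ∈ u ++ List.replicate m 0 ++ w, a ∈ box A r := by
  refine List.forall_mem_append.2 ⟨List.forall_mem_append.2 ⟨hu, fun a ha => ?_⟩, hw⟩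
  exact List.eq_of_mem_replicate ha ▸ zero_mem_box r

theorem interiorLanguage_eq_stableInterior (hM : IsIrreduciblePisotUnimodular M β)
    (hR : IsPisotSplitting M β R) (hK : IsValueBound M β R K) {P : Submodule ℝ (A → ℝ)}
    (hP : IsCompl P (realEigenspace M β)) {μ : ℕ} (hμ1 : 1 ≤ μ) (hμ : ‖realMatrix M‖ ≤ μ)
    (hr : μ ≤ r) (hL : ∀ u ∈ L, ∀ a ∈ u, a ∈ box A r) :
    interiorLanguage M (P.projectionOnto (realEigenspace M β) hP) L =
      stableInterior (box A r) 0 L (nonnegWords M r) (padClosure 0 (valueWords M r L)) := by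
  ext u
  refine and_congr_right fun huL => ?_
  have hu := hL u huL
  rw [hR.mem_discreteInterior_projectionOnto_iff]
  refine and_congr (iff_and_self.2 fun _ => hu) ⟨?_, ?_⟩
  · rintro ⟨ε, hε, h⟩
    obtain ⟨m, hm⟩ := hK.exists_forall_append_mem hR hε h r
    exact ⟨m, fun w hw hnonneg => mem_padClosure_valueWords.2
      ⟨hnonneg.1, hm w hw hnonneg.2⟩⟩
  · rintro ⟨m, hm⟩
    have hdet : IsUnit M.det := Int.isUnit_iff.2 hM.det_eq
    obtain ⟨ε, hε, h⟩ := hR.exists_forall_eq_wordValue_append hdet hμ1 hμ u m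
    refine ⟨ε, hε, fun y hy hyu => ?_⟩
    obtain ⟨w, hw, rfl⟩ := h y hyu
    have hw' : ∀ a ∈ w, a ∈ box A r := fun a ha =>
      mem_box.2 fun i => (mem_box.1 (hw a ha) i).trans hr
    exact (mem_padClosure_valueWords.1
      (hm w hw' ⟨forall_mem_append_replicate_append hu hw' m, hy⟩)).2

/-- The common state map of the three languages that define the interior language. -/
def interiorState {C : Type*} (κ : List (A → ℤ) → C) (M : Matrix A A ℤ) (r K : ℕ)
    (T : Finset (A → ℤ)) (L : Language (A → ℤ)) (u : List (A → ℤ)) :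
    C × (Prop × Set T) × Prop × Set (C × box A (4 * K * r)) × Set (box A (4 * K * r)) :=
  (κ u, nonnegState M r T u, valueState κ M r (4 * K * r) L u)

section InteriorState

variable {C : Type*} {κ : List (A → ℤ) → C} {T : Finset (A → ℤ)}

theorem isStateMap_interiorState (hκ : IsStateMap κ L) :
    IsStateMap (interiorState κ M r K T L) L :=
  hκ.of_factorsThrough fun _ _ h => congrArg Prod.fst h

theorem isStateMap_interiorState_nonnegWords (hK : IsValueBound M β R K)
    (hR : IsPisotSplitting M β R) (hT : IsTrap M r (3 * K * r) T) :
    IsStateMap (interiorState κ M r K T L) (nonnegWords M r) :=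
  (isStateMap_nonnegState hK hR hT).of_factorsThrough fun _ _ h => congrArg (·.2.1) h

theorem isStateMap_interiorState_valueWords (hK : IsValueBound M β R K)
    (hR : IsPisotSplitting M β R) (hκ : IsStateMap κ L) (hL : ∀ u ∈ L, ∀ a ∈ u, a ∈ box A r) :
    IsStateMap (interiorState κ M r K T L) (valueWords M r L) :=
  (isStateMap_valueState hK hR hκ hL).of_factorsThrough fun _ _ h => congrArg (·.2.2) h

end InteriorState

theorem exists_norm_realMatrix_le (M : Matrix A A ℤ) : ∃ μ : ℕ, 1 ≤ μ ∧ ‖realMatrix M‖ ≤ μ :=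
  ⟨⌈‖realMatrix M‖⌉₊ + 1, Nat.le_add_left _ _,
    (Nat.le_ceil _).trans (Nat.cast_le.2 (Nat.le_add_right _ _))⟩

theorem exists_forall_mem_box (s : Finset (A → ℤ)) (μ : ℕ) : ∃ r, μ ≤ r ∧ ∀ a ∈ s, a ∈ box A r := by
  refine ⟨μ + ∑ a ∈ s, ⌈‖realVector a‖⌉₊, Nat.le_add_right _ _, fun a ha => ?_⟩
  refine mem_box_iff_norm_le.2 ((Nat.le_ceil _).trans (Nat.cast_le.2 ?_))
  exact (Finset.single_le_sum (f := fun a => ⌈‖realVector a‖⌉₊) (fun _ _ => Nat.zero_le _) ha).trans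
    (Nat.le_add_left _ _)

theorem isRegular_interiorLanguage (hM : IsIrreduciblePisotUnimodular M β)
    {P : Submodule ℝ (A → ℝ)} (hP : IsCompl P (realEigenspace M β)) {alphabet : Finset (A → ℤ)}
    (hL : ∀ u ∈ L, ∀ a ∈ u, a ∈ alphabet) (hreg : L.IsRegular) :
    (interiorLanguage M (P.projectionOnto (realEigenspace M β) hP) L).IsRegular := by
  obtain ⟨μ, hμ1, hμ⟩ := exists_norm_realMatrix_le M
  obtain ⟨r, hr, hbox⟩ := exists_forall_mem_box alphabet μ
  obtain ⟨R, hR⟩ := hM.exists_isPisotSplitting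
  obtain ⟨g, hg⟩ := hM.exists_isDominantRelation
  have hK := hg.isValueBound hR hμ1 hμ
  obtain ⟨T, hT⟩ := hK.exists_isTrap hM hR r (3 * orbitBound g μ * r)
  have hLr : ∀ u ∈ L, ∀ a ∈ u, a ∈ box A r := fun u hu a ha => hbox a (hL u hu a ha)
  have : Finite (Set.range L.leftQuotient) := hreg.finite_range_leftQuotient
  have hκ : IsStateMap (Set.rangeFactorization L.leftQuotient) L :=
    (isStateMap_leftQuotient L).of_factorsThrough fun _ _ h => congrArg Subtype.val h
  rw [interiorLanguage_eq_stableInterior hM hR hK hP hμ1 hμ hr hLr]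
  exact ((isStateMap_interiorState (K := orbitBound g μ) (T := T) hκ).stableInterior
    (isStateMap_interiorState_nonnegWords hK hR hT)
    ((isStateMap_interiorState_valueWords hK hR hκ hLr).padClosure 0) _ _).isRegular

end Interior

section PrimrecTools

open Primrec

variable {α β : Type*} [Primcodable α] [Primcodable β]

theorem primrecPred_imp {p q : α → Prop} (hp : PrimrecPred p) (hq : PrimrecPred q) :
    PrimrecPred fun a => p a → q a :=
  (hp.not.or hq).of_eq fun _ => imp_iff_not_or.symm

theorem primrecPred_iff {p q : α → Prop} (hp : PrimrecPred p) (hq : PrimrecPred q) :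
    PrimrecPred fun a => p a ↔ q a :=
  ((primrecPred_imp hp hq).and (primrecPred_imp hq hp)).of_eq fun _ => iff_def.symm

theorem primrecPred_forall_mem {l : α → List β} {p : α → β → Prop} (hl : Primrec l)
    (hp : PrimrecPred fun x : α × β => p x.1 x.2) : PrimrecPred fun a => ∀ b ∈ l a, p a b :=
  (PrimrecRel.forall_mem_list (R := fun b a => p a b) (hp.comp (snd.pair fst))).comp hl .id

theorem primrecPred_exists_mem {l : α → List β} {p : α → β → Prop} (hl : Primrec l)
    (hp : PrimrecPred fun x : α × β => p x.1 x.2) : PrimrecPred fun a => ∃ b ∈ l a, p a b :=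
  (PrimrecRel.exists_mem_list (R := fun b a => p a b) (hp.comp (snd.pair fst))).comp hl .id

theorem primrecPred_mem_list {f : α → β} {l : α → List β} (hf : Primrec f) (hl : Primrec l) :
    PrimrecPred fun a => f a ∈ l a :=
  (primrecPred_exists_mem (p := fun a b => b = f a) hl
    (Primrec.eq.comp snd (hf.comp fst))).of_eq fun _ => by simp

theorem primrec_nat_pow : Primrec₂ ((· ^ ·) : ℕ → ℕ → ℕ) :=
  Primrec₂.unpaired'.1 Nat.Primrec.pow

theorem primrec_intEquivNatSumNat : Primrec Equiv.intEquivNatSumNat :=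
  Primrec.encode_iff.1 (Primrec.encode.of_eq fun z => by cases z <;> rfl)

theorem primrec_intEquivNatSumNat_symm : Primrec Equiv.intEquivNatSumNat.symm :=
  Primrec.encode_iff.1 (Primrec.encode.of_eq fun s => by cases s <;> rfl)

theorem primrec_int_toNat : Primrec Int.toNat :=
  (Primrec.sumCasesOn primrec_intEquivNatSumNat Primrec₂.right (Primrec₂.const 0)).of_eq
    fun z => by cases z <;> rfl

theorem primrec_int_neg_toNat : Primrec fun z : ℤ => (-z).toNat :=
  (Primrec.sumCasesOn primrec_intEquivNatSumNat (Primrec₂.const 0)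
    (Primrec.succ.comp₂ Primrec₂.right)).of_eq fun z => by
    cases z with
    | ofNat n => exact (Int.toNat_of_nonpos (by simp)).symm
    | negSucc n => rfl

theorem primrec_natCast_sub_natCast : Primrec₂ fun m n : ℕ => (m : ℤ) - n := by
  refine (primrec_intEquivNatSumNat_symm.comp (Primrec.ite (c := fun x : ℕ × ℕ => x.2 ≤ x.1)
    (Primrec.nat_le.comp snd fst) (sumInl.comp (Primrec.nat_sub.comp fst snd))
    (sumInr.comp (Primrec.pred.comp (Primrec.nat_sub.comp snd fst))))).of_eq ?_
  rintro ⟨m, n⟩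
  dsimp only
  split_ifs with h
  · exact Int.ofNat_sub h
  · change Int.negSucc (n - m - 1) = _
    omega

theorem primrec_int_natAbs : Primrec Int.natAbs :=
  (Primrec.nat_add.comp primrec_int_toNat primrec_int_neg_toNat).of_eq fun _ => by omega

theorem primrecPred_int_nonneg : PrimrecPred fun z : ℤ => 0 ≤ z :=
  (Primrec.eq.comp primrec_int_neg_toNat (Primrec.const 0)).of_eq fun _ => by omega

theorem primrec_int_add : Primrec₂ ((· + ·) : ℤ → ℤ → ℤ) := by
  refine (primrec_natCast_sub_natCast.comp
    (Primrec.nat_add.comp (primrec_int_toNat.comp fst) (primrec_int_toNat.comp snd))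
    (Primrec.nat_add.comp (primrec_int_neg_toNat.comp fst)
      (primrec_int_neg_toNat.comp snd))).of_eq fun x => ?_
  dsimp only
  omega

theorem primrec_int_mul : Primrec₂ ((· * ·) : ℤ → ℤ → ℤ) := by
  have pos₁ := primrec_int_toNat.comp (fst (α := ℤ) (β := ℤ))
  have pos₂ := primrec_int_toNat.comp (snd (α := ℤ) (β := ℤ))
  have neg₁ := primrec_int_neg_toNat.comp (fst (α := ℤ) (β := ℤ))
  have neg₂ := primrec_int_neg_toNat.comp (snd (α := ℤ) (β := ℤ))
  refine (primrec_natCast_sub_natCast.comp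
    (Primrec.nat_add.comp (Primrec.nat_mul.comp pos₁ pos₂) (Primrec.nat_mul.comp neg₁ neg₂))
    (Primrec.nat_add.comp (Primrec.nat_mul.comp pos₁ neg₂)
      (Primrec.nat_mul.comp neg₁ pos₂))).of_eq ?_
  rintro ⟨x, y⟩
  conv_rhs => rw [← Int.toNat_sub_toNat_neg x, ← Int.toNat_sub_toNat_neg y]
  push_cast
  ring

theorem primrec_list_sum [Add β] [Zero β] (h : Primrec₂ ((· + ·) : β → β → β)) :
    Primrec (List.sum : List β → β) :=
  (Primrec.list_foldr (h := fun _ p => p.1 + p.2) Primrec.id (Primrec.const 0)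
    (h.comp (fst.comp snd) (snd.comp snd)).to₂).of_eq fun _ => rfl

theorem primrec_list_replicate : Primrec₂ (List.replicate : ℕ → α → List α) :=
  (Primrec.list_map (list_range.comp fst) (snd.comp fst).to₂).of_eq fun _ => by simp

/-- The list of the words of length `n` over the letters in `l`. -/
def wordsOfLength {α : Type*} (l : List α) (n : ℕ) : List (List α) :=
  Nat.rec [[]] (fun _ ws => ws.flatMap fun w => l.map (· :: w)) n

theorem mem_wordsOfLength {α : Type*} {l : List α} {n : ℕ} {w : List α} :
    w ∈ wordsOfLength l n ↔ w.length = n ∧ ∀ a ∈ w, a ∈ l := by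
  induction n generalizing w with
  | zero => simp +contextual [wordsOfLength]
  | succ n ih =>
    change w ∈ (wordsOfLength l n).flatMap _ ↔ _
    simp only [List.mem_flatMap, List.mem_map, ih]
    cases w <;> simp [and_left_comm]

/-- The list of the words of length less than `n` over the letters in `l`. -/
def wordsOfLengthLT {α : Type*} (l : List α) (n : ℕ) : List (List α) :=
  (List.range n).flatMap (wordsOfLength l)

theorem mem_wordsOfLengthLT {α : Type*} {l : List α} {n : ℕ} {w : List α} :
    w ∈ wordsOfLengthLT l n ↔ w.length < n ∧ ∀ a ∈ w, a ∈ l := by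
  simp [wordsOfLengthLT, mem_wordsOfLength]

theorem primrec_wordsOfLength : Primrec₂ (wordsOfLength : List α → ℕ → List (List α)) :=
  Primrec.nat_rec (Primrec.const [[]]) (Primrec.list_flatMap (snd.comp snd)
    (Primrec.list_map (fst.comp fst) (Primrec.list_cons.comp snd (snd.comp fst)).to₂).to₂).to₂

theorem primrec_wordsOfLengthLT : Primrec₂ (wordsOfLengthLT : List α → ℕ → List (List α)) :=
  Primrec.list_flatMap (list_range.comp snd) (primrec_wordsOfLength.comp (fst.comp fst) snd).to₂

theorem exists_partrec_forall_mem_and_dom {p : α → β → Prop} (hp : PrimrecRel p) :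
    ∃ f : α →. β, Partrec f ∧ ∀ a, (∀ b ∈ f a, p a b) ∧ ((∃ b, p a b) → (f a).Dom) := by
  classical
  let test (a : α) (n : ℕ) : Option β :=
    (Encodable.decode n).bind fun b => if p a b then some b else none
  have mem_test (a : α) (n : ℕ) (b : β) :
      b ∈ test a n ↔ Encodable.decode n = some b ∧ p a b := by
    simp only [test, Option.mem_def, Option.bind_eq_some_iff, Option.ite_none_right_eq_some,
      Option.some.injEq]
    exact ⟨fun ⟨_, hn, hp, h⟩ => h ▸ ⟨hn, hp⟩, fun ⟨hn, hp⟩ => ⟨b, hn, hp, rfl⟩⟩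
  have htest : Primrec₂ test :=
    Primrec.option_bind (Primrec.decode.comp snd) (Primrec.ite
      (hp.comp (fst.comp fst) snd) (option_some.comp snd) (Primrec.const none)).to₂
  refine ⟨fun a => Nat.rfindOpt (test a), Partrec.rfindOpt htest.to_comp, fun a => ⟨?_, ?_⟩⟩
  · intro b hb
    obtain ⟨n, hn⟩ := Nat.rfindOpt_spec hb
    exact ((mem_test a n b).1 hn).2
  · rintro ⟨b, hb⟩
    exact Nat.rfindOpt_dom.2 ⟨Encodable.encode b, b,
      (mem_test a _ b).2 ⟨Encodable.encodek b, hb⟩⟩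

end PrimrecTools

section Codes

open Primrec

variable {α : Type*} [Primcodable α]

/-- The zero vector as the list of its coordinates. -/
def codeZero (d : ℕ) : List ℤ := List.replicate d 0

/-- The list of the coordinates of `x + M h`, where `m` is the list of the rows of `M`. -/
def codeStep (m : List (List ℤ)) (x h : List ℤ) : List ℤ :=
  (List.range m.length).map fun i => x.getD i 0 +
    ((List.range m.length).map fun j => (m.getD i []).getD j 0 * h.getD j 0).sum

/-- `wordValue` for vectors given as lists, evaluated by the Horner scheme. -/
def codeValue (m : List (List ℤ)) (w : List (List ℤ)) : List ℤ :=
  w.foldr (codeStep m) (codeZero m.length)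

/-- The list of the vectors of `box (Fin d) r`, given as lists. -/
def codeBox (d r : ℕ) : List (List ℤ) :=
  wordsOfLength ((List.range (2 * r + 1)).map fun n : ℕ => (n : ℤ) - r) d

/-- The sum of the absolute values of the entries. -/
def codeNorm (x : List (List ℤ)) : ℕ := (x.map fun y => (y.map Int.natAbs).sum).sum

section MatrixCode

variable {d : ℕ} (M : Matrix (Fin d) (Fin d) ℤ)

theorem getD_ofFn {β : Type*} (f : Fin d → β) (b : β) (i : Fin d) :
    (List.ofFn f).getD i b = f i := by
  simp [List.getD]

theorem map_range_eq_ofFn {β : Type*} (f : ℕ → β) :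
    (List.range d).map f = List.ofFn fun i : Fin d => f i :=
  List.ext_getElem (by simp) fun i _ _ => by simp

theorem length_matrixCode : (matrixCode M).length = d := List.length_ofFn

theorem codeZero_eq_ofFn : codeZero d = List.ofFn (0 : Fin d → ℤ) :=
  (List.ofFn_const d 0).symm

theorem codeStep_matrixCode (x h : Fin d → ℤ) :
    codeStep (matrixCode M) (List.ofFn x) (List.ofFn h) = List.ofFn (x + M *ᵥ h) := by
  simp only [codeStep, length_matrixCode]
  simp only [map_range_eq_ofFn, List.sum_ofFn, matrixCode, getD_ofFn]
  rfl

theorem codeValue_matrixCode (w : List (Fin d → ℤ)) :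
    codeValue (matrixCode M) (w.map List.ofFn) = List.ofFn (wordValue M w) := by
  induction w with
  | nil =>
    rw [wordValue_nil, ← codeZero_eq_ofFn, List.map_nil, codeValue, List.foldr_nil,
      length_matrixCode]
  | cons x w ih =>
    rw [wordValue_cons, ← codeStep_matrixCode, ← ih]
    rfl

theorem mem_codeBox {r : ℕ} {l : List ℤ} :
    l ∈ codeBox d r ↔ ∃ x ∈ box (Fin d) r, List.ofFn x = l := by
  have mem_interval (z : ℤ) :
      z ∈ (List.range (2 * r + 1)).map (fun n : ℕ => (n : ℤ) - r) ↔ z.natAbs ≤ r := by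
    simp only [List.mem_map, List.mem_range]
    exact ⟨fun ⟨n, hn, h⟩ => by omega, fun h => ⟨(z + r).toNat, by omega, by omega⟩⟩
  simp only [codeBox, mem_wordsOfLength, mem_interval, mem_box]
  constructor
  · rintro ⟨rfl, h⟩
    exact ⟨l.get, fun i => h _ (List.get_mem l i), List.ofFn_get l⟩
  · rintro ⟨x, hx, rfl⟩
    exact ⟨List.length_ofFn, List.forall_mem_ofFn_iff.2 hx⟩

theorem forall_mem_codeBox {r : ℕ} {p : List ℤ → Prop} :
    (∀ l ∈ codeBox d r, p l) ↔ ∀ x ∈ box (Fin d) r, p (List.ofFn x) := by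
  simp [mem_codeBox]

theorem mem_wordsOfLengthLT_codeBox {r n : ℕ} {l : List (List ℤ)} :
    l ∈ wordsOfLengthLT (codeBox d r) n ↔ ∃ w : List (Fin d → ℤ),
      (w.length < n ∧ ∀ a ∈ w, a ∈ box (Fin d) r) ∧ w.map List.ofFn = l := by
  rw [mem_wordsOfLengthLT]
  constructor
  · rintro ⟨hn, h⟩
    have hl : l ∈ Set.range (List.map fun x : box (Fin d) r => List.ofFn x.1) := by
      rw [Set.range_list_map]
      intro a ha
      obtain ⟨x, hx, rfl⟩ := mem_codeBox.1 (h a ha)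
      exact ⟨⟨x, hx⟩, rfl⟩
    obtain ⟨w, rfl⟩ := hl
    exact ⟨w.map (↑), ⟨by simpa using hn, by simp +contextual⟩, by simp⟩
  · rintro ⟨w, ⟨hn, hw⟩, rfl⟩
    refine ⟨by simpa using hn, fun a ha => ?_⟩
    obtain ⟨x, hx, rfl⟩ := List.mem_map.1 ha
    exact mem_codeBox.2 ⟨x, hw x hx, rfl⟩

theorem natAbs_le_codeNorm {x : List (List ℤ)} {y : List ℤ} (hy : y ∈ x) {z : ℤ} (hz : z ∈ y) :
    z.natAbs ≤ codeNorm x :=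
  (List.le_sum_of_mem (List.mem_map.2 ⟨z, hz, rfl⟩)).trans
    (List.le_sum_of_mem (List.mem_map.2 ⟨y, hy, rfl⟩))

open scoped Matrix.Norms.Operator in
theorem norm_realMatrix_le_codeNorm : ‖realMatrix M‖ ≤ codeNorm (matrixCode M) := by
  have hrow (i : Fin d) : ∑ j, (M i j).natAbs ≤ codeNorm (matrixCode M) := by
    simp only [codeNorm, matrixCode, List.map_ofFn, List.sum_ofFn, Function.comp_apply]
    exact Finset.single_le_sum (f := fun i => ∑ j, (M i j).natAbs)
      (fun _ _ => Nat.zero_le _) (Finset.mem_univ i)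
  rw [linfty_opNorm_def, ← NNReal.coe_natCast, NNReal.coe_le_coe]
  refine Finset.sup_le fun i _ => ?_
  have hnorm : ∑ j, ‖realMatrix M i j‖₊ = ((∑ j, (M i j).natAbs : ℕ) : NNReal) :=
    NNReal.eq (by simp [realMatrix, Nat.cast_natAbs])
  exact hnorm ▸ Nat.cast_le.2 (hrow i)

end MatrixCode

theorem primrec_codeZero : Primrec codeZero :=
  primrec_list_replicate.comp .id (Primrec.const 0)

theorem primrec_codeStep {m : α → List (List ℤ)} {x h : α → List ℤ} (hm : Primrec m)
    (hx : Primrec x) (hh : Primrec h) : Primrec fun a => codeStep (m a) (x a) (h a) := by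
  have hrange : Primrec fun a => List.range (m a).length := list_range.comp (list_length.comp hm)
  have hentry : Primrec fun p : (α × ℕ) × ℕ => ((m p.1.1).getD p.1.2 []).getD p.2 0 :=
    (list_getD (0 : ℤ)).comp ((list_getD []).comp (hm.comp (fst.comp fst)) (snd.comp fst)) snd
  have hproduct : Primrec fun p : (α × ℕ) × ℕ =>
      ((m p.1.1).getD p.1.2 []).getD p.2 0 * (h p.1.1).getD p.2 0 :=
    primrec_int_mul.comp hentry ((list_getD 0).comp (hh.comp (fst.comp fst)) snd)
  exact list_map hrange (primrec_int_add.comp ((list_getD 0).comp (hx.comp fst) snd)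
    ((primrec_list_sum primrec_int_add).comp (list_map (hrange.comp fst) hproduct.to₂))).to₂

theorem primrec_codeValue : Primrec₂ codeValue :=
  list_foldr snd (primrec_codeZero.comp (list_length.comp fst))
    (primrec_codeStep (fst.comp fst) (fst.comp snd) (snd.comp snd)).to₂

theorem primrec_codeBox : Primrec₂ codeBox :=
  primrec_wordsOfLength.comp
    (list_map (list_range.comp (succ.comp (nat_mul.comp (Primrec.const 2) snd)))
      (primrec_natCast_sub_natCast.comp snd (snd.comp fst)).to₂) fst

theorem primrec_sum_map_natAbs : Primrec fun y : List ℤ => (y.map Int.natAbs).sum :=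
  (primrec_list_sum nat_add).comp (list_map .id (primrec_int_natAbs.comp snd).to₂)

theorem primrec_codeNorm : Primrec codeNorm :=
  (primrec_list_sum nat_add).comp (list_map .id (primrec_sum_map_natAbs.comp snd).to₂)

end Codes

namespace AutomatonCode

open Primrec

/-- The list of the states reached after reading the word `w`, whose letters are given as
lists. -/
def run (c : AutomatonCode) (w : List (List ℤ)) : List ℕ :=
  w.foldl (fun qs a => c.2.2.filterMap fun t =>
    if t.1 ∈ qs ∧ t.2.1 = a then some t.2.2 else none) c.1

/-- The automaton accepts the word `w`, whose letters are given as lists. -/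
def Accepts (c : AutomatonCode) (w : List (List ℤ)) : Prop := ∃ q ∈ c.run w, q ∈ c.2.1

theorem primrec_run : Primrec₂ run := by
  let Input := (AutomatonCode × List (List ℤ)) × List ℕ × List ℤ
  have htransition : PrimrecPred fun x : Input × ℕ × List ℤ × ℕ =>
      x.2.1 ∈ x.1.2.1 ∧ x.2.2.1 = x.1.2.2 :=
    (primrecPred_mem_list (fst.comp snd) (fst.comp (snd.comp fst))).and
      (Primrec.eq.comp (fst.comp (snd.comp snd)) (snd.comp (snd.comp fst)))
  exact list_foldl snd (fst.comp fst) (listFilterMap (snd.comp (snd.comp (fst.comp fst)))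
    (Primrec.ite htransition (option_some.comp (snd.comp (snd.comp snd)))
      (Primrec.const none)).to₂).to₂

theorem primrecRel_accepts : PrimrecRel Accepts :=
  primrecPred_exists_mem (α := AutomatonCode × List (List ℤ)) primrec_run
    (primrecPred_mem_list snd (fst.comp (snd.comp (fst.comp fst))))

/-- The states that are initial or the end of a transition, hence all the reachable states. -/
def states (c : AutomatonCode) : Finset ℕ := (c.1 ++ c.2.2.map fun t => t.2.2).toFinset

/-- A bound for the number of the states, computed without comparing them. -/
def size (c : AutomatonCode) : ℕ := c.1.length + c.2.2.length

/-- A bound for the absolute values of the coordinates of the letters. -/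
def radius (c : AutomatonCode) : ℕ := codeNorm (c.2.2.map fun t => t.2.1)

theorem primrec_size : Primrec size :=
  nat_add.comp (list_length.comp fst) (list_length.comp (snd.comp snd))

theorem primrec_radius : Primrec radius :=
  primrec_codeNorm.comp (list_map (snd.comp snd) (fst.comp (snd.comp snd)).to₂)

theorem card_states_le (c : AutomatonCode) : c.states.card ≤ c.size := by
  refine (List.toFinset_card_le _).trans ?_
  rw [List.length_append, List.length_map, size]

variable {d : ℕ}

theorem mem_run (c : AutomatonCode) (w : List (Fin d → ℤ)) (q : ℕ) :
    q ∈ c.run (w.map List.ofFn) ↔ q ∈ (c.toNFA d).eval w := by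
  induction w using List.reverseRecOn generalizing q with
  | nil => rfl
  | append_singleton w a ih =>
    rw [List.map_append, run, List.foldl_append, ← run, NFA.eval_append_singleton,
      NFA.mem_stepSet]
    simp only [List.map_cons, List.map_nil, List.foldl_cons, List.foldl_nil, List.mem_filterMap,
      Option.ite_none_right_eq_some, Option.some.injEq]
    constructor
    · rintro ⟨⟨p, _, _⟩, ht, ⟨hp, rfl⟩, rfl⟩
      exact ⟨p, (ih p).1 hp, ht⟩
    · rintro ⟨p, hp, ht⟩
      exact ⟨(p, List.ofFn a, q), ht, ⟨(ih p).2 hp, rfl⟩, rfl⟩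

theorem accepts_iff (c : AutomatonCode) (w : List (Fin d → ℤ)) :
    c.Accepts (w.map List.ofFn) ↔ w ∈ c.language d := by
  refine exists_congr fun q => ?_
  rw [mem_run, and_comm]
  rfl

/-- The set of the states reached after reading the word `u`. -/
def stateSet (c : AutomatonCode) (u : List (Fin d → ℤ)) : Set c.states :=
  {q | (q : ℕ) ∈ (c.toNFA d).eval u}

theorem mem_states_of_mem_eval {c : AutomatonCode} {u : List (Fin d → ℤ)} {q : ℕ}
    (h : q ∈ (c.toNFA d).eval u) : q ∈ c.states := by
  rw [states, List.mem_toFinset, List.mem_append]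
  induction u using List.reverseRecOn with
  | nil => exact Or.inl h
  | append_singleton w a _ =>
    rw [NFA.eval_append_singleton, NFA.mem_stepSet] at h
    obtain ⟨p, _, ht⟩ := h
    exact Or.inr (List.mem_map.2 ⟨_, ht, rfl⟩)

theorem isStateMap_stateSet (c : AutomatonCode) :
    IsStateMap (stateSet (d := d) c) (c.language d) := by
  intro u v huv w
  have heval : (c.toNFA d).eval u = (c.toNFA d).eval v := by
    ext q
    by_cases hq : q ∈ c.states
    · exact Set.ext_iff.1 huv ⟨q, hq⟩
    · exact iff_of_false (hq ∘ mem_states_of_mem_eval) (hq ∘ mem_states_of_mem_eval)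
  have mem_iff (s : List (Fin d → ℤ)) : s ++ w ∈ c.language d ↔
      w ∈ (c.toNFA d).acceptsFrom ((c.toNFA d).eval s) := (c.toNFA d).append_mem_acceptsFrom
  rw [mem_iff, mem_iff, heval]

theorem isRegular_language (c : AutomatonCode) (d : ℕ) : (c.language d).IsRegular :=
  c.isStateMap_stateSet.isRegular

theorem mem_box_of_mem_language {c : AutomatonCode} {r : ℕ} (hr : c.radius ≤ r)
    {u : List (Fin d → ℤ)} (hu : u ∈ c.language d) : ∀ a ∈ u, a ∈ box (Fin d) r := by
  obtain ⟨q, -, hq⟩ := hu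
  induction u using List.reverseRecOn generalizing q with
  | nil => simp
  | append_singleton w a ih =>
    rw [NFA.eval_append_singleton, NFA.mem_stepSet] at hq
    obtain ⟨p, hp, ht⟩ := hq
    refine List.forall_mem_append.2 ⟨ih p hp, List.forall_mem_singleton.2 (mem_box.2 fun i => ?_)⟩
    exact (natAbs_le_codeNorm (List.mem_map.2 ⟨_, ht, rfl⟩) (List.mem_ofFn.2 ⟨i, rfl⟩)).trans hr

open Classical in
/-- The automaton that runs the deterministic automaton `D` on the words over the letters of
`B`. -/
noncomputable def ofDFA {n : ℕ} (D : DFA (Fin d → ℤ) (Fin n)) (B : Finset (Fin d → ℤ)) :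
    AutomatonCode :=
  ([(D.start : ℕ)], (Finset.univ.filter (· ∈ D.accept)).toList.map fun s => (s : ℕ),
    (Finset.univ ×ˢ B).toList.map fun x : Fin n × (Fin d → ℤ) =>
      ((x.1 : ℕ), List.ofFn x.2, (D.step x.1 x.2 : ℕ)))

section OfDFA

variable {n : ℕ} (D : DFA (Fin d → ℤ) (Fin n)) (B : Finset (Fin d → ℤ))

theorem mem_step_ofDFA (s : Fin n) (a : Fin d → ℤ) (q : ℕ) :
    q ∈ ((ofDFA D B).toNFA d).step s a ↔ a ∈ B ∧ q = D.step s a := by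
  change ((s : ℕ), List.ofFn a, q) ∈ (ofDFA D B).2.2 ↔ _
  simp only [ofDFA, List.mem_map, Finset.mem_toList, Finset.mem_product, Finset.mem_univ, true_and,
    Prod.mk.injEq]
  constructor
  · rintro ⟨⟨s', a'⟩, ha, hs, ha', rfl⟩
    obtain rfl := Fin.ext hs
    obtain rfl := List.ofFn_injective ha'
    exact ⟨ha, rfl⟩
  · rintro ⟨ha, rfl⟩
    exact ⟨(s, a), ha, rfl, rfl, rfl⟩

theorem mem_eval_ofDFA (u : List (Fin d → ℤ)) (q : ℕ) :
    q ∈ ((ofDFA D B).toNFA d).eval u ↔ (∀ a ∈ u, a ∈ B) ∧ q = D.eval u := by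
  induction u using List.reverseRecOn generalizing q with
  | nil => exact List.mem_singleton.trans (by simp)
  | append_singleton w a ih =>
    simp only [NFA.eval_append_singleton, NFA.mem_stepSet, ih, DFA.eval_append_singleton,
      List.forall_mem_append, List.forall_mem_singleton, and_assoc]
    constructor
    · rintro ⟨_, hw, rfl, hq⟩
      exact ⟨hw, (mem_step_ofDFA D B _ a q).1 hq⟩
    · rintro ⟨hw, ha⟩
      exact ⟨_, hw, rfl, (mem_step_ofDFA D B _ a q).2 ha⟩

theorem language_ofDFA :
    (ofDFA D B).language d = {u | u ∈ D.accepts ∧ ∀ a ∈ u, a ∈ B} := by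
  ext u
  have hacc : ((D.eval u : Fin n) : ℕ) ∈ ((ofDFA D B).toNFA d).accept ↔ D.eval u ∈ D.accept := by
    change (D.eval u : ℕ) ∈ (ofDFA D B).2.1 ↔ _
    simp [ofDFA, Fin.val_inj]
  constructor
  · rintro ⟨q, hq, hqu⟩
    obtain ⟨hu, rfl⟩ := (mem_eval_ofDFA D B u q).1 hqu
    exact ⟨hacc.1 hq, hu⟩
  · rintro ⟨hu, hB⟩
    exact ⟨_, hacc.2 hu, (mem_eval_ofDFA D B u _).2 ⟨hB, rfl⟩⟩

end OfDFA

theorem exists_language_eq {L : Language (Fin d → ℤ)} (hL : L.IsRegular)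
    (B : Finset (Fin d → ℤ)) (hB : ∀ u ∈ L, ∀ a ∈ u, a ∈ B) :
    ∃ c : AutomatonCode, c.language d = L := by
  obtain ⟨σ, _, D, rfl⟩ := hL
  refine ⟨ofDFA (DFA.reindex (Fintype.equivFin σ) D) B, ?_⟩
  rw [language_ofDFA, DFA.accepts_reindex]
  exact Set.ext fun u => and_iff_left_of_imp (hB u)

end AutomatonCode

section Checks

open Primrec

/-- The value of the word `t` is nonnegative. -/
def CodeNonneg (m t : List (List ℤ)) : Prop := ∀ y ∈ codeValue m t, 0 ≤ y

/-- The words of length less than `n` with letters in the box of radius `r`. -/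
def codeWords (m : List (List ℤ)) (r n : ℕ) : List (List (List ℤ)) :=
  wordsOfLengthLT (codeBox m.length r) n

/-- The value of `t` is the value of a word accepted by `c` whose length exceeds the length of `t`
by less than `S`. -/
def CodeHasValue (m : List (List ℤ)) (c : AutomatonCode) (r S : ℕ) (t : List (List ℤ)) : Prop :=
  ∃ v ∈ codeWords m r (t.length + S), c.Accepts v ∧ codeValue m v = codeValue m t

/-- The word `u` belongs to the interior language, as far as paddings and continuations of length
less than `S` can tell. -/
def CodeInterior (m : List (List ℤ)) (c : AutomatonCode) (r S : ℕ) (u : List (List ℤ)) : Prop :=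
  c.Accepts u ∧ CodeNonneg m u ∧ ∃ k ∈ List.range S, ∀ w ∈ codeWords m r S,
    CodeNonneg m (u ++ List.replicate k (codeZero m.length) ++ w) →
      CodeHasValue m c r S (u ++ List.replicate k (codeZero m.length) ++ w)

/-- The automaton `c'` recognizes the interior of the language of `c`, as far as words of length
less than `S` can tell. -/
def CodeRecognizes (m : List (List ℤ)) (c : AutomatonCode) (r S : ℕ) (c' : AutomatonCode) : Prop :=
  ∀ u ∈ codeWords m r S, c'.Accepts u ↔ CodeInterior m c r S u

/-- The test for `IsDominantRelation`. -/
def CodeRelation (m : List (List ℤ)) (g : List ℤ) : Prop :=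
  (∀ v ∈ codeBox m.length 1,
    codeValue m (g.map fun z => v.map (z * ·)) = codeZero m.length) ∧
  ∃ z ∈ g, (g.map Int.natAbs).sum < 2 * z.natAbs

/-- The test for `IsTrap`. -/
def CodeTrap (m : List (List ℤ)) (r b : ℕ) (T : List (List ℤ)) : Prop :=
  codeZero m.length ∈ T ∧ ∀ h ∈ T, ∀ x ∈ codeBox m.length r,
    codeStep m x h ∈ T ∨ ∀ y ∈ codeStep m x h, b < y.natAbs

variable {α : Type*} [Primcodable α] {m t T : α → List (List ℤ)} {c c' : α → AutomatonCode}
  {r S b : α → ℕ} {g : α → List ℤ}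

theorem primrecPred_codeNonneg (hm : Primrec m) (ht : Primrec t) :
    PrimrecPred fun a => CodeNonneg (m a) (t a) :=
  primrecPred_forall_mem (primrec_codeValue.comp hm ht) (primrecPred_int_nonneg.comp snd)

theorem primrec_codeWords (hm : Primrec m) (hr : Primrec r) (hS : Primrec S) :
    Primrec fun a => codeWords (m a) (r a) (S a) :=
  primrec_wordsOfLengthLT.comp (primrec_codeBox.comp (list_length.comp hm) hr) hS

theorem primrecPred_codeHasValue (hm : Primrec m) (hc : Primrec c) (hr : Primrec r)
    (hS : Primrec S) (ht : Primrec t) :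
    PrimrecPred fun a => CodeHasValue (m a) (c a) (r a) (S a) (t a) :=
  primrecPred_exists_mem (primrec_codeWords hm hr (nat_add.comp (list_length.comp ht) hS))
    ((AutomatonCode.primrecRel_accepts.comp (hc.comp fst) snd).and
      (Primrec.eq.comp (primrec_codeValue.comp (hm.comp fst) snd)
        (primrec_codeValue.comp (hm.comp fst) (ht.comp fst))))

theorem primrecPred_codeInterior (hm : Primrec m) (hc : Primrec c) (hr : Primrec r)
    (hS : Primrec S) (ht : Primrec t) :
    PrimrecPred fun a => CodeInterior (m a) (c a) (r a) (S a) (t a) := by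
  have hm' : Primrec fun x : (α × ℕ) × List (List ℤ) => m x.1.1 := hm.comp (fst.comp fst)
  have hpad : Primrec fun x : (α × ℕ) × List (List ℤ) =>
      t x.1.1 ++ List.replicate x.1.2 (codeZero (m x.1.1).length) ++ x.2 :=
    list_append.comp (list_append.comp (ht.comp (fst.comp fst))
      (primrec_list_replicate.comp (snd.comp fst)
        (primrec_codeZero.comp (list_length.comp hm')))) snd
  exact (AutomatonCode.primrecRel_accepts.comp hc ht).and ((primrecPred_codeNonneg hm ht).and
    (primrecPred_exists_mem (list_range.comp hS) (primrecPred_forall_mem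
      (primrec_codeWords (hm.comp fst) (hr.comp fst) (hS.comp fst))
      (primrecPred_imp (primrecPred_codeNonneg hm' hpad) (primrecPred_codeHasValue hm'
        (hc.comp (fst.comp fst)) (hr.comp (fst.comp fst)) (hS.comp (fst.comp fst)) hpad)))))

theorem primrecPred_codeRecognizes (hm : Primrec m) (hc : Primrec c) (hr : Primrec r)
    (hS : Primrec S) (hc' : Primrec c') :
    PrimrecPred fun a => CodeRecognizes (m a) (c a) (r a) (S a) (c' a) :=
  primrecPred_forall_mem (primrec_codeWords hm hr hS)
    (primrecPred_iff (AutomatonCode.primrecRel_accepts.comp (hc'.comp fst) snd)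
      (primrecPred_codeInterior (hm.comp fst) (hc.comp fst) (hr.comp fst) (hS.comp fst) snd))

theorem primrecPred_codeRelation (hm : Primrec m) (hg : Primrec g) :
    PrimrecPred fun a => CodeRelation (m a) (g a) := by
  have hd : Primrec fun a => (m a).length := list_length.comp hm
  have hmul : Primrec fun x : α × List ℤ => (g x.1).map fun z => x.2.map (z * ·) :=
    list_map (hg.comp fst) (list_map (snd.comp fst)
      (primrec_int_mul.comp (snd.comp fst) snd).to₂).to₂
  exact (primrecPred_forall_mem (primrec_codeBox.comp hd (Primrec.const 1))
    (Primrec.eq.comp (primrec_codeValue.comp (hm.comp fst) hmul)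
      (primrec_codeZero.comp (hd.comp fst)))).and
    (primrecPred_exists_mem hg (nat_lt.comp (primrec_sum_map_natAbs.comp (hg.comp fst))
      (nat_mul.comp (Primrec.const 2) (primrec_int_natAbs.comp snd))))

theorem primrecPred_codeTrap (hm : Primrec m) (hr : Primrec r) (hb : Primrec b)
    (hT : Primrec T) : PrimrecPred fun a => CodeTrap (m a) (r a) (b a) (T a) := by
  have hd : Primrec fun a => (m a).length := list_length.comp hm
  have hstep : Primrec fun x : (α × List ℤ) × List ℤ => codeStep (m x.1.1) x.2 x.1.2 :=
    primrec_codeStep (hm.comp (fst.comp fst)) snd (snd.comp fst)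
  exact (primrecPred_mem_list (primrec_codeZero.comp hd) hT).and
    (primrecPred_forall_mem hT (primrecPred_forall_mem
      (primrec_codeBox.comp (hd.comp fst) (hr.comp fst))
      ((primrecPred_mem_list hstep (hT.comp (fst.comp fst))).or
        (primrecPred_forall_mem hstep (nat_lt.comp (hb.comp (fst.comp (fst.comp fst)))
          (primrec_int_natAbs.comp snd))))))

theorem primrec_orbitBound : Primrec₂ orbitBound :=
  nat_mul.comp (primrec_sum_map_natAbs.comp fst) (nat_mul.comp (list_length.comp fst)
    (primrec_nat_pow.comp snd (list_length.comp fst)))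

end Checks

section Certificate

open Primrec

/-- The number of the values of `interiorState`, together with the sets of the states of a second
automaton: `d` is the dimension, `s` and `s'` are the numbers of the states, `τ` is the size of the
trap and `b` is the radius of the box of `valueState`. -/
def stateBound (d s s' τ b : ℕ) : ℕ :=
  2 ^ s * (2 * 2 ^ τ * (2 * (2 ^ (2 ^ s * (2 * b + 1) ^ d) * 2 ^ (2 * b + 1) ^ d))) * 2 ^ s'

/-- A bound for the norm of the matrix `m` and for the letters of the automata `c` and `c'`. -/
def certificateRadius (m : List (List ℤ)) (c c' : AutomatonCode) : ℕ :=
  codeNorm m + 1 + c.radius + c'.radius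

/-- The relation `g` and the trap `T` certify that the state maps have few enough values for
finitely many tests to prove that `c'` recognizes the interior of the language of `c`, and `c'`
passes these tests. -/
def IsCertificate (m : List (List ℤ)) (c : AutomatonCode) (g : List ℤ) (T : List (List ℤ))
    (c' : AutomatonCode) : Prop :=
  let K := orbitBound g (codeNorm m + 1)
  let r := certificateRadius m c c'
  CodeRelation m g ∧ CodeTrap m r (3 * K * r) T ∧
    CodeRecognizes m c r (stateBound m.length c.size c'.size T.length (4 * K * r)) c'

theorem primrec_stateBound {α : Type*} [Primcodable α] {d s s' τ b : α → ℕ} (hd : Primrec d)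
    (hs : Primrec s) (hs' : Primrec s') (hτ : Primrec τ) (hb : Primrec b) :
    Primrec fun a => stateBound (d a) (s a) (s' a) (τ a) (b a) := by
  have two_pow {f : α → ℕ} (hf : Primrec f) : Primrec fun a => 2 ^ f a :=
    primrec_nat_pow.comp (Primrec.const 2) hf
  have two_mul {f : α → ℕ} (hf : Primrec f) : Primrec fun a => 2 * f a :=
    nat_mul.comp (Primrec.const 2) hf
  have hbox : Primrec fun a => (2 * b a + 1) ^ d a :=
    primrec_nat_pow.comp (succ.comp (two_mul hb)) hd
  exact nat_mul.comp (nat_mul.comp (two_pow hs) (nat_mul.comp (two_mul (two_pow hτ))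
    (two_mul (nat_mul.comp (two_pow (nat_mul.comp (two_pow hs) hbox)) (two_pow hbox)))))
    (two_pow hs')

theorem primrecRel_isCertificate :
    PrimrecRel fun (x : List (List ℤ) × AutomatonCode)
      (w : List ℤ × List (List ℤ) × AutomatonCode) => IsCertificate x.1 x.2 w.1 w.2.1 w.2.2 := by
  let Input := (List (List ℤ) × AutomatonCode) × List ℤ × List (List ℤ) × AutomatonCode
  have hm : Primrec fun x : Input => x.1.1 := fst.comp fst
  have hc : Primrec fun x : Input => x.1.2 := snd.comp fst
  have hg : Primrec fun x : Input => x.2.1 := fst.comp snd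
  have hT : Primrec fun x : Input => x.2.2.1 := fst.comp (snd.comp snd)
  have hc' : Primrec fun x : Input => x.2.2.2 := snd.comp (snd.comp snd)
  have hμ : Primrec fun x : Input => codeNorm x.1.1 + 1 := succ.comp (primrec_codeNorm.comp hm)
  have hK := primrec_orbitBound.comp hg hμ
  have hr : Primrec fun x : Input => certificateRadius x.1.1 x.1.2 x.2.2.2 :=
    nat_add.comp (nat_add.comp hμ (AutomatonCode.primrec_radius.comp hc))
      (AutomatonCode.primrec_radius.comp hc')
  have hbound (n : ℕ) : Primrec fun x : Input => n * orbitBound x.2.1 (codeNorm x.1.1 + 1) *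
      certificateRadius x.1.1 x.1.2 x.2.2.2 := nat_mul.comp (nat_mul.comp (Primrec.const n) hK) hr
  exact (primrecPred_codeRelation hm hg).and ((primrecPred_codeTrap hm hr (hbound 3) hT).and
    (primrecPred_codeRecognizes hm hc hr (primrec_stateBound (list_length.comp hm)
      (AutomatonCode.primrec_size.comp hc) (AutomatonCode.primrec_size.comp hc')
      (list_length.comp hT) (hbound 4)) hc'))

end Certificate

section Correctness

variable {d : ℕ} {M : Matrix (Fin d) (Fin d) ℤ} {c c' : AutomatonCode} {r S : ℕ}
  {C : Type*} [Fintype C] {f : List (Fin d → ℤ) → C}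

theorem codeNonneg_iff {t : List (Fin d → ℤ)} :
    CodeNonneg (matrixCode M) (t.map List.ofFn) ↔ ∀ i, 0 ≤ wordValue M t i := by
  rw [CodeNonneg, codeValue_matrixCode, List.forall_mem_ofFn_iff]

theorem forall_mem_codeWords {n : ℕ} {p : List (List ℤ) → Prop} :
    (∀ l ∈ codeWords (matrixCode M) r n, p l) ↔ ∀ w : List (Fin d → ℤ), w.length < n →
      (∀ a ∈ w, a ∈ box (Fin d) r) → p (w.map List.ofFn) := by
  rw [codeWords, length_matrixCode]
  simp only [mem_wordsOfLengthLT_codeBox, forall_exists_index, and_imp]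
  exact ⟨fun h w hn hw => h _ w hn hw rfl, fun h _ w hn hw hl => hl ▸ h w hn hw⟩

theorem exists_mem_codeWords {n : ℕ} {p : List (List ℤ) → Prop} :
    (∃ l ∈ codeWords (matrixCode M) r n, p l) ↔ ∃ w : List (Fin d → ℤ),
      (w.length < n ∧ ∀ a ∈ w, a ∈ box (Fin d) r) ∧ p (w.map List.ofFn) := by
  rw [codeWords, length_matrixCode]
  simp only [mem_wordsOfLengthLT_codeBox]
  exact ⟨fun ⟨_, ⟨w, hw, hl⟩, h⟩ => ⟨w, hw, hl ▸ h⟩, fun ⟨w, hw, h⟩ => ⟨_, ⟨w, hw, rfl⟩, h⟩⟩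

theorem codeHasValue_iff (hf : IsStateMap f (valueWords M r (c.language d)))
    (hS : Fintype.card C ≤ S) (hc : c.radius ≤ r) {t : List (Fin d → ℤ)}
    (ht : ∀ a ∈ t, a ∈ box (Fin d) r) :
    CodeHasValue (matrixCode M) c r S (t.map List.ofFn) ↔
      t ∈ padClosure 0 (valueWords M r (c.language d)) := by
  simp only [CodeHasValue, exists_mem_codeWords, AutomatonCode.accepts_iff, codeValue_matrixCode,
    List.ofFn_injective.eq_iff, List.length_map]
  constructor
  · rintro ⟨v, -, hv, hvt⟩
    exact mem_padClosure_valueWords.2 ⟨ht, v, hv, hvt⟩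
  · rw [hf.mem_padClosure_iff hS]
    rintro ⟨k, hk, -, v, hv, hlen, hval⟩
    rw [List.length_append, List.length_replicate] at hlen
    rw [wordValue_append, wordValue_replicate_zero, mulVec_zero, add_zero] at hval
    exact ⟨v, ⟨by omega, AutomatonCode.mem_box_of_mem_language hc hv⟩, hv, hval⟩

theorem codeInterior_iff (h₁ : IsStateMap f (nonnegWords M r))
    (h₂ : IsStateMap f (valueWords M r (c.language d))) (hS : Fintype.card C ≤ S)
    (hc : c.radius ≤ r) {u : List (Fin d → ℤ)} (hu : ∀ a ∈ u, a ∈ box (Fin d) r) :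
    CodeInterior (matrixCode M) c r S (u.map List.ofFn) ↔
      u ∈ stableInterior (box (Fin d) r) 0 (c.language d) (nonnegWords M r)
        (padClosure 0 (valueWords M r (c.language d))) := by
  have hnonneg {t : List (Fin d → ℤ)} (ht : ∀ a ∈ t, a ∈ box (Fin d) r) :
      CodeNonneg (matrixCode M) (t.map List.ofFn) ↔ t ∈ nonnegWords M r :=
    codeNonneg_iff.trans (and_iff_right ht).symm
  have hpad (k : ℕ) (w : List (Fin d → ℤ)) :
      u.map List.ofFn ++ List.replicate k (codeZero d) ++ w.map List.ofFn =
        (u ++ List.replicate k 0 ++ w).map List.ofFn := by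
    rw [List.map_append, List.map_append, List.map_replicate, codeZero_eq_ofFn]
  rw [mem_stableInterior_iff_of_isStateMap h₁ (h₂.padClosure 0) hS, CodeInterior]
  refine and_congr (c.accepts_iff u) (and_congr (hnonneg hu) ?_)
  simp only [forall_mem_codeWords, length_matrixCode, hpad, List.mem_range]
  refine exists_congr fun k => and_congr_right fun _ => forall_congr' fun w =>
    forall_congr' fun _ => forall_congr' fun hw => ?_
  have ht := forall_mem_append_replicate_append hu hw k
  exact imp_congr (hnonneg ht) (codeHasValue_iff h₂ hS hc ht)

theorem codeRecognizes_iff (h : IsStateMap f (c.language d)) (h' : IsStateMap f (c'.language d))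
    (h₁ : IsStateMap f (nonnegWords M r)) (h₂ : IsStateMap f (valueWords M r (c.language d)))
    (hS : Fintype.card C ≤ S) (hc : c.radius ≤ r) (hc' : c'.radius ≤ r) :
    CodeRecognizes (matrixCode M) c r S c' ↔ c'.language d =
      stableInterior (box (Fin d) r) 0 (c.language d) (nonnegWords M r)
        (padClosure 0 (valueWords M r (c.language d))) := by
  have hshort : CodeRecognizes (matrixCode M) c r S c' ↔ ∀ u : List (Fin d → ℤ), u.length < S →
      (∀ a ∈ u, a ∈ box (Fin d) r) → (u ∈ c'.language d ↔
        u ∈ stableInterior (box (Fin d) r) 0 (c.language d) (nonnegWords M r)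
          (padClosure 0 (valueWords M r (c.language d)))) := by
    rw [CodeRecognizes, forall_mem_codeWords]
    refine forall_congr' fun u => forall_congr' fun _ => forall_congr' fun hu => ?_
    rw [AutomatonCode.accepts_iff, codeInterior_iff h₁ h₂ hS hc hu]
  rw [hshort]
  refine ⟨fun H => ?_, fun H u _ _ => by rw [H]⟩
  exact eq_of_forall_mem_iff_of_length_lt h' (h.stableInterior h₁ (h₂.padClosure 0) _ _)
    (fun u hu => AutomatonCode.mem_box_of_mem_language hc' hu)
    (fun u hu => AutomatonCode.mem_box_of_mem_language hc hu.1) hS H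

theorem codeRelation_iff {g : List ℤ} :
    CodeRelation (matrixCode M) g ↔ IsDominantRelation M g := by
  have hcode (v : Fin d → ℤ) :
      codeValue (matrixCode M) (g.map fun z => (List.ofFn v).map (z * ·)) = codeZero d ↔
        wordValue M (g.map (· • v)) = 0 := by
    rw [codeZero_eq_ofFn, ← List.ofFn_injective.eq_iff, ← codeValue_matrixCode, List.map_map]
    simp only [List.map_ofFn]
    rfl
  rw [CodeRelation, length_matrixCode, forall_mem_codeBox]
  simp only [hcode]
  refine ⟨fun ⟨hbox, hdom⟩ => ⟨fun v => ?_, hdom⟩, fun h => ⟨fun v _ => h.1 v, h.2⟩⟩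
  have hzero : ∑ i ∈ Finset.range g.length, g.getD i 0 • M ^ i = 0 :=
    ext_of_mulVec_single fun a => by
      rw [zero_mulVec, ← wordValue_map_smul]
      refine hbox _ (mem_box.2 fun i => ?_)
      rw [Pi.single_apply]
      split_ifs <;> simp
  rw [wordValue_map_smul, hzero, zero_mulVec]

theorem CodeTrap.exists_isTrap {b : ℕ} {T : List (List ℤ)} (hT : CodeTrap (matrixCode M) r b T) :
    ∃ T' : Finset (Fin d → ℤ), IsTrap M r b T' ∧ T'.card ≤ T.length := by
  have hinj : Set.InjOn List.ofFn ((List.ofFn : (Fin d → ℤ) → List ℤ) ⁻¹' T.toFinset) :=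
    List.ofFn_injective.injOn
  have mem_preimage (x : Fin d → ℤ) : x ∈ T.toFinset.preimage List.ofFn hinj ↔ List.ofFn x ∈ T := by
    rw [Finset.mem_preimage, List.mem_toFinset]
  obtain ⟨hzero, hstep⟩ := hT
  rw [length_matrixCode] at hzero hstep
  refine ⟨T.toFinset.preimage List.ofFn hinj, ⟨?_, fun h hh x hx => ?_⟩, ?_⟩
  · rwa [mem_preimage, ← codeZero_eq_ofFn]
  · have := forall_mem_codeBox.1 (hstep _ ((mem_preimage h).1 hh)) x hx
    rwa [codeStep_matrixCode, List.forall_mem_ofFn_iff, ← mem_preimage] at this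
  · exact (Finset.card_le_card_of_injOn List.ofFn (fun _ => Finset.mem_preimage.1)
      List.ofFn_injective.injOn).trans (List.toFinset_card_le T)

theorem IsTrap.codeTrap {b : ℕ} {T : Finset (Fin d → ℤ)} (hT : IsTrap M r b T) :
    CodeTrap (matrixCode M) r b (T.toList.map List.ofFn) := by
  have mem_map (x : Fin d → ℤ) : List.ofFn x ∈ T.toList.map List.ofFn ↔ x ∈ T := by
    rw [List.mem_map_of_injective List.ofFn_injective, Finset.mem_toList]
  rw [CodeTrap, length_matrixCode, codeZero_eq_ofFn, mem_map]
  refine ⟨hT.zero_mem, List.forall_mem_map.2 fun h hh => forall_mem_codeBox.2 fun x hx => ?_⟩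
  rw [codeStep_matrixCode, List.forall_mem_ofFn_iff, mem_map]
  exact hT.step h (Finset.mem_toList.1 hh) x hx

end Correctness

section CertificateCorrectness

open scoped Matrix.Norms.Operator

variable {d : ℕ} {M : Matrix (Fin d) (Fin d) ℤ} {β : ℝ} {P : Submodule ℝ (Fin d → ℝ)}
  {c c' : AutomatonCode} {g : List ℤ} {T : List (List ℤ)}

theorem card_interiorState_le (c c' : AutomatonCode) {T : Finset (Fin d → ℤ)} {τ : ℕ}
    (hT : T.card ≤ τ) (b : ℕ) :
    Fintype.card ((Set c.states × (Prop × Set T) × Prop ×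
      Set (Set c.states × box (Fin d) b) × Set (box (Fin d) b)) × Set c'.states) ≤
        stateBound d c.size c'.size τ b := by
  simp only [Fintype.card_prod, Fintype.card_set, Fintype.card_coe, Fintype.card_prop, card_box,
    Fintype.card_fin, stateBound]
  have h := c.card_states_le
  have h' := c'.card_states_le
  gcongr <;> norm_num

theorem isCertificate_iff_language_eq (hM : IsIrreduciblePisotUnimodular M β)
    (hP : IsCompl P (realEigenspace M β)) (hg : CodeRelation (matrixCode M) g)
    (hT : CodeTrap (matrixCode M) (certificateRadius (matrixCode M) c c')
      (3 * orbitBound g (codeNorm (matrixCode M) + 1) * certificateRadius (matrixCode M) c c') T) :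
    IsCertificate (matrixCode M) c g T c' ↔ c'.language d =
      interiorLanguage M (P.projectionOnto (realEigenspace M β) hP) (c.language d) := by
  classical
  simp only [IsCertificate, hg, hT, true_and, length_matrixCode]
  set μ := codeNorm (matrixCode M) + 1 with hμ
  set r := certificateRadius (matrixCode M) c c' with hr
  rw [certificateRadius, ← hμ] at hr
  have hμ1 : 1 ≤ μ := Nat.le_add_left _ _
  have hnorm : ‖realMatrix M‖ ≤ μ :=
    (norm_realMatrix_le_codeNorm M).trans (Nat.cast_le.2 (Nat.le_succ _))
  obtain ⟨R, hR⟩ := hM.exists_isPisotSplitting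
  have hK := (codeRelation_iff.1 hg).isValueBound hR hμ1 hnorm
  obtain ⟨T', hT', hcard⟩ := hT.exists_isTrap
  have hL : ∀ u ∈ c.language d, ∀ a ∈ u, a ∈ box (Fin d) r :=
    fun _ => AutomatonCode.mem_box_of_mem_language (by omega)
  have hκ := c.isStateMap_stateSet (d := d)
  let state := interiorState c.stateSet M r (orbitBound g μ) T' (c.language d)
  have hfst (u v : List (Fin d → ℤ)) (h : (state u, c'.stateSet u) = (state v, c'.stateSet v)) :
      state u = state v := congrArg Prod.fst h
  rw [interiorLanguage_eq_stableInterior hM hR hK hP hμ1 hnorm (by omega) hL]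
  exact codeRecognizes_iff (f := fun u => (state u, c'.stateSet u))
    ((isStateMap_interiorState hκ).of_factorsThrough hfst)
    (c'.isStateMap_stateSet.of_factorsThrough fun _ _ h => congrArg Prod.snd h)
    ((isStateMap_interiorState_nonnegWords hK hR hT').of_factorsThrough hfst)
    ((isStateMap_interiorState_valueWords hK hR hκ hL).of_factorsThrough hfst)
    (card_interiorState_le c c' hcard _) (by omega) (by omega)

theorem IsCertificate.language_eq (hw : IsCertificate (matrixCode M) c g T c')
    (hM : IsIrreduciblePisotUnimodular M β) (hP : IsCompl P (realEigenspace M β)) :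
    c'.language d =
      interiorLanguage M (P.projectionOnto (realEigenspace M β) hP) (c.language d) :=
  (isCertificate_iff_language_eq hM hP hw.1 hw.2.1).1 hw

theorem exists_isCertificate (hM : IsIrreduciblePisotUnimodular M β)
    (hP : IsCompl P (realEigenspace M β)) (c : AutomatonCode) :
    ∃ g T c', IsCertificate (matrixCode M) c g T c' := by
  have hL : ∀ u ∈ c.language d, ∀ a ∈ u, a ∈ box (Fin d) c.radius :=
    fun _ => AutomatonCode.mem_box_of_mem_language le_rfl
  obtain ⟨c', hc'⟩ := AutomatonCode.exists_language_eq
    (isRegular_interiorLanguage hM hP hL (c.isRegular_language d)) (box (Fin d) c.radius)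
    fun u hu => hL u hu.1
  obtain ⟨R, hR⟩ := hM.exists_isPisotSplitting
  obtain ⟨g, hg⟩ := hM.exists_isDominantRelation
  have hnorm : ‖realMatrix M‖ ≤ (codeNorm (matrixCode M) + 1 : ℕ) :=
    (norm_realMatrix_le_codeNorm M).trans (Nat.cast_le.2 (Nat.le_succ _))
  obtain ⟨T, hT⟩ := (hg.isValueBound hR (Nat.le_add_left _ _) hnorm).exists_isTrap hM hR
    (certificateRadius (matrixCode M) c c') _
  exact ⟨g, _, c',
    (isCertificate_iff_language_eq hM hP (codeRelation_iff.2 hg) hT.codeTrap).2 hc'⟩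

end CertificateCorrectness

theorem mainTheorem3 :
    (∀ (A : Type*) [Fintype A] [DecidableEq A] (alphabet : Finset (A → ℤ))
        (L : Language (A → ℤ)) (M : Matrix A A ℤ) (β : ℝ) (P : Submodule ℝ (A → ℝ))
        (hP : IsCompl P (realEigenspace M β)),
        (∀ u ∈ L, ∀ a ∈ u, a ∈ alphabet) → L.IsRegular →
        IsIrreduciblePisotUnimodular M β →
        (interiorLanguage M (P.projectionOnto (realEigenspace M β) hP) L).IsRegular ∧
        languageValue M
            (interiorLanguage M (P.projectionOnto (realEigenspace M β) hP) L) =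
          discreteInterior (P.projectionOnto (realEigenspace M β) hP)
            (languageValue M L)) ∧
    (∃ f : List (List ℤ) × AutomatonCode →. AutomatonCode, Partrec f ∧
      ∀ (d : ℕ) (M : Matrix (Fin d) (Fin d) ℤ) (β : ℝ) (P : Submodule ℝ (Fin d → ℝ))
        (hP : IsCompl P (realEigenspace M β)),
        IsIrreduciblePisotUnimodular M β →
        ∀ c : AutomatonCode, ∃ c' ∈ f (matrixCode M, c),
          c'.language d =
            interiorLanguage M (P.projectionOnto (realEigenspace M β) hP)
              (c.language d)) := by
  obtain ⟨search, hsearch, hcertificate⟩ :=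
    exists_partrec_forall_mem_and_dom primrecRel_isCertificate
  have hproj : Computable fun w : List ℤ × List (List ℤ) × AutomatonCode => w.2.2 :=
    Computable.snd.comp Computable.snd
  have hpartrec : Partrec fun x => (search x).map fun w => w.2.2 :=
    hsearch.map (hproj.comp Computable.snd).to₂
  refine ⟨fun A _ _ alphabet L M β P hP hL hreg hM =>
      ⟨isRegular_interiorLanguage hM hP hL hreg, languageValue_interiorLanguage _ _ _⟩,
    _, hpartrec, fun d M β P hP hM c => ?_⟩
  obtain ⟨hmem, hdom⟩ := hcertificate (matrixCode M, c)
  obtain ⟨g, T, c', hc'⟩ := exists_isCertificate hM hP c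
  obtain ⟨w, hw⟩ := Part.dom_iff_mem.1 (hdom ⟨(g, T, c'), hc'⟩)
  have hcert : IsCertificate (matrixCode M) c w.1 w.2.1 w.2.2 := hmem w hw
  exact ⟨w.2.2, Part.mem_map (fun w => w.2.2) hw, hcert.language_eq hM hP⟩
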